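/- **Theorem 3.8.** Let $d\ge 1$, $\Omega=[0,1]^d$, $\sigma(s)=s/(1+e^{-s})$. Fix a depth $L\ge 1$ and widths $d_0=d,d_1,\dots,d_{L-1}\ge 1$, $d_L=1$. For $\theta=\{(A_i,B_i)\}_{i=1}^{L}\in\mathbb R^D$ with $A_i\in\mathbb R^{d_i\times d_{i-1}}$, $B_i\in\mathbb R^{d_i}$, let $v(\cdot;\theta)=T_L\circ\sigma\circ T_{L-1}\circ\cdots\circ\sigma\circ T_1$ with $T_i(s)=A_is+B_i$ and $\sigma$ acting componentwise. Let $B_\Theta>0$ and $\Theta=\{\theta\in\mathbb R^D:\|\theta\|_{\ell_\infty}\le B_\Theta\}$. Let $V,g:\Omega\to\mathbb R$ be measurable with $0<V_{min}\le V\le V_{max}<\infty$ and $g$ bounded (almost everywhere on $\Omega$). For the static Schrödinger equation $-\Delta u+Vu=g$ with Neumann boundary condition put $$\mu_S(x;\theta)=\tfrac12\|\nabla_xv(x;\theta)\|_{\ell_2}^2-g(x)v(x;\theta)+\tfrac12V(x)|v(x;\theta)|^2,\qquad \mathcal L_S(\theta)=\int_\Omega\mu_S(x;\theta)\,\mathrm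 dx .$$ Given a step $\alpha$, an initial $\theta_0$ and mini-batches $\xi_k=(X_{1,k},\dots,X_{n,k})$, $k=0,1,2,\dots$, let $$\theta_{k+1}=\theta_k-\alpha\,\nabla_\theta\Big[\frac1n\sum_{j=1}^n\mu_S(X_{j,k};\theta)\Big]_{\theta=\theta_k}.$$ The gradient $\nabla_\theta\mathcal L_S$ is Lipschitz continuous on $\Theta$ (in the $\ell_2$ norm). Let $K\subseteq\Theta$ be nonempty, closed and convex (for example $K=\Theta$). Let $L_7$ be a Lipschitz constant of $\nabla_\theta\mathcal L_S$ on $K$, let $0<c<L_7$, and suppose that for all $\theta,\bar\theta\in K$ $$\mathcal L_S(\bar\theta)\ge\mathcal L_S(\theta)+\nabla_\theta\mathcal L_S(\theta)^T(\bar\theta-\theta)+\frac c2\|\bar\theta-\theta\|_{\ell_2}^2 .$$ Let $0<\alpha<2/L_7$ be constant. Then $\mathcal L_S$ has a minimizer $\theta^*$ over $K$ such that the following hold. 1. (MC-based DRM.) There is a constant $C$ such that for every $n\ge1$, every deterministic $\theta_0$ and all i.i.d. uniform random points $X_{j,k}$ on $\Omega$ ($1\le j\le n$, $k\ge0$): if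 $\theta_k\in K$ almost surely for every $k$, then $\mathcal L_S(\theta_k)$ is integrable for every $k$ and $$\limsup_{k\to\infty}\mathbb E\big[\mathcal L_S(\theta_k)-\mathcal L_S(\theta^*)\big]\le C\,n^{-1}.$$ 2. (QMC-based DRM.) Suppose in addition that $V,g\in C^d(\Omega)$. (a) For every $R$ there is a constant $C$ such that for every $n\ge2$, every $\theta_0$ and all mini-batches $\xi_k$ of $n$ points of $\Omega$ whose star discrepancies satisfy $D_n^*(\xi_k)\le R\,n^{-1}(\log n)^d$ for all $k$: if $\theta_k\in K$ for every $k$, then $$\limsup_{k\to\infty}\mathcal L_S(\theta_k)-\mathcal L_S(\theta^*)\le C\,n^{-1}(\log n)^d .$$ (b) For every $t\in\mathbb N$ there is a constant $C$ such that the bound in (a) holds for every $(t,d)$-sequence $P_1,P_2,\dots$ in base $2$ in $[0,1)^d$ (for example a Sobol' sequence), every $n=2^\tau$ with $\tau\ge1$, the mini-batches $X_{j,k}=P_{kn+j}$, and every $\theta_0$ such that $\theta_k\in K$ for every $k$. Here $(t,d)$-sequence in base $2$ means that for all $m>t$ and $k\ge0$ every dyadic box $\prod_{i=1}^d[a_i2^{-e_i},(a_i+1)2^{-e_i})\subseteq[0,1)^d$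 of volume $2^{t-m}$, with integers $e_i\ge 0$ and $0\le a_i<2^{e_i}$, contains exactly $2^t$ of the points $P_{k2^m+1},\dots,P_{(k+1)2^m}$. For $K=\Theta$ the quantities bounded are the training errors of DRM and DRM-QMC. -/

import Mathlib

open MeasureTheory ProbabilityTheory Filter

noncomputable section

namespace DeepRitz

/-- Euclidean space `ℝ^d`. -/
abbrev Pt (d : ℕ) : Type := EuclideanSpace ℝ (Fin d)

/-- The closed unit cube `Ω = [0,1]^d`. -/
def cube (d : ℕ) : Set (Pt d) := {x | ∀ i, 0 ≤ x i ∧ x i ≤ 1}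

/-- The uniform distribution on the unit cube (which has Lebesgue measure one). -/
def unif (d : ℕ) : Measure (Pt d) := volume.restrict (cube d)

/-! ### Deep neural networks with the swish activation -/

/-- The swish function. -/
def swish (s : ℝ) : ℝ := s / (1 + Real.exp (-s))

/-- A fully connected architecture: the depth `L ≥ 1` and the layer widths `d_0, …, d_L`
(the values of `width` beyond `L` play no role), with scalar output `d_L = 1`. -/
structure Arch where
  depth : ℕ
  width : ℕ → ℕ
  depth_pos : 1 ≤ depth
  width_pos : ∀ i, i ≤ depth → 1 ≤ width i
  width_out : width depth = 1

namespace Arch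

variable (N : Arch)

/-- The input dimension `d = d_0`. -/
abbrev dim : ℕ := N.width 0

/-- Index set of the weights: the entries of the matrices `A_{i+1} ∈ ℝ^{d_{i+1} × d_i}` and of the
vectors `B_{i+1} ∈ ℝ^{d_{i+1}}`, for `0 ≤ i < L`. Its cardinality is `D`. -/
abbrev Idx : Type :=
  Σ i : Fin N.depth,
    (Fin (N.width (i.val + 1)) × Fin (N.width i.val)) ⊕ Fin (N.width (i.val + 1))

/-- The space `ℝ^D` of all weights, with the `ℓ₂` norm. -/
abbrev Param : Type := EuclideanSpace ℝ N.Idx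

/-- `N.layer θ x l` is `T_l ∘ σ ∘ T_{l-1} ∘ ⋯ ∘ σ ∘ T_1 (x)`, and `x` for `l = 0`. No activation is
applied to the input, nor after the last affine map. -/
def layer (θ : N.Param) (x : Pt N.dim) : (l : ℕ) → l ≤ N.depth → Fin (N.width l) → ℝ
  | 0, _ => fun r => x r
  | l + 1, h => fun r =>
      (∑ s, θ ⟨⟨l, h⟩, Sum.inl (r, s)⟩ *
        (if l = 0 then layer θ x l (Nat.le_of_succ_le h) s
          else swish (layer θ x l (Nat.le_of_succ_le h) s)))
        + θ ⟨⟨l, h⟩, Sum.inr r⟩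

/-- The realization `v(x; θ)` of the network. -/
def v (x : Pt N.dim) (θ : N.Param) : ℝ :=
  N.layer θ x N.depth le_rfl ⟨0, N.width_pos N.depth le_rfl⟩

/-- The set `Θ` of weights with `‖θ‖_∞ ≤ B`. -/
def Theta (B : ℝ) : Set N.Param := {θ | ∀ i, |θ i| ≤ B}

/-! ### Losses of the static Schrödinger equation `-Δu + V u = g` and gradient descent -/

variable (V g : Pt N.dim → ℝ)

/-- The integrand `½ ‖∇_x v(x;θ)‖² - g(x) v(x;θ) + ½ V(x) |v(x;θ)|²`. -/
def integrand (x : Pt N.dim) (θ : N.Param) : ℝ :=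
  1 / 2 * ‖gradient (fun y => N.v y θ) x‖ ^ 2 - g x * N.v x θ + 1 / 2 * V x * |N.v x θ| ^ 2

/-- The loss `L_S(θ) = L_S(v(·;θ))`. -/
def loss (θ : N.Param) : ℝ := ∫ x in cube N.dim, N.integrand V g x θ

/-- The empirical loss on a mini-batch `X_1, …, X_n`. -/
def empLoss {n : ℕ} (X : Fin n → Pt N.dim) (θ : N.Param) : ℝ :=
  (1 / (n : ℝ)) * ∑ j, N.integrand V g (X j) θ

/-- Mini-batch gradient descent with constant step `α`: `X k` is the mini-batch used in the step
from `θ_k` to `θ_{k+1}`. -/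
def iter (α : ℝ) (θ₀ : N.Param) {n : ℕ} (X : ℕ → Fin n → Pt N.dim) : ℕ → N.Param
  | 0 => θ₀
  | k + 1 => iter α θ₀ X k - α • gradient (N.empLoss V g (X k)) (iter α θ₀ X k)

/-- `ℓ` is a Lipschitz constant of `∇_θ L_S` on the set `K`. -/
def GradLipschitzOn (K : Set N.Param) (ℓ : ℝ) : Prop :=
  ∀ θ ∈ K, ∀ θ' ∈ K,
    ‖gradient (N.loss V g) θ - gradient (N.loss V g) θ'‖ ≤ ℓ * ‖θ - θ'‖

/-- `L_S` is strongly convex with constant `c` on the set `K`. -/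
def LossStronglyConvexOn (K : Set N.Param) (c : ℝ) : Prop :=
  ∀ θ ∈ K, ∀ θ' ∈ K,
    N.loss V g θ + inner ℝ (gradient (N.loss V g) θ) (θ' - θ) + c / 2 * ‖θ' - θ‖ ^ 2
      ≤ N.loss V g θ'

end Arch

/-! ### Low discrepancy points -/

open Classical in
/-- The star discrepancy `sup_{a ∈ [0,1]^d} | #{j : X_j ∈ [0,a)} / n - ∏ a_i |` of `n` points of the
unit cube. -/
def starDiscrepancy {d n : ℕ} (X : Fin n → Pt d) : ℝ :=
  sSup ((fun a : Pt d =>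
    |((Finset.univ.filter fun j => ∀ i, X j i < a i).card : ℝ) / n - ∏ i, a i|) '' cube d)

open Classical in
/-- `(t, m, d)`-nets in base 2: `2^m` points such that every elementary dyadic box
`∏ [a_i 2^{-e_i}, (a_i + 1) 2^{-e_i})` of volume `2^{t-m}` contains exactly `2^t` of them. -/
def IsNet {d : ℕ} (t m : ℕ) (X : Fin (2 ^ m) → Pt d) : Prop :=
  t ≤ m ∧ ∀ e a : Fin d → ℕ, (∑ i, e i) + t = m → (∀ i, a i < 2 ^ e i) →
    (Finset.univ.filter fun j => ∀ i,
      (a i : ℝ) / 2 ^ e i ≤ X j i ∧ X j i < ((a i : ℝ) + 1) / 2 ^ e i).card = 2 ^ t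

/-- The `k`-th block of `n` consecutive points of an infinite sequence, `k = 0, 1, 2, …`. -/
def block {d : ℕ} (P : ℕ → Pt d) (n k : ℕ) : Fin n → Pt d := fun j => P (k * n + j.val)

/-- `(t, d)`-sequences in base 2 (such as Sobol' sequences): points of `[0,1)^d` such that, for all
`m > t`, all the blocks of `2^m` consecutive points are `(t, m, d)`-nets in base 2. -/
def IsTSequence {d : ℕ} (t : ℕ) (P : ℕ → Pt d) : Prop :=
  (∀ j i, 0 ≤ P j i ∧ P j i < 1) ∧ ∀ m, t < m → ∀ k, IsNet t m (block P (2 ^ m) k)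

end DeepRitz

end

noncomputable section

namespace DeepRitz

/-! Everything rests on a perturbed gradient descent inequality. On the convex set `K` the Lipschitz
gradient gives the descent lemma, and strong convexity gives the Polyak-Łojasiewicz inequality `2c(f
θ - f z) ≤ ‖∇f θ‖²` for every `z ∈ K`. For a step taken with gradient `∇f θ + r` they combine
(`step_bound`) to bound the new gap to `f z` by `q` times the old one, plus `(α²L - α)⟨∇f θ, r⟩ +
α²L/2 ‖r‖²`, where `q = 1 - 2cα(1 - αL/2)` lies in `[0, 1)`. With `z` the minimizer, which exists by
compactness, a bound `e` on the error terms makes the limsup of the gaps at most `e / (1 - q)`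
(`limsup_le_of_le_mul_add`). The gradient need not vanish at the minimizer, which may lie on the
boundary of `K`.

Monte Carlo: the mini-batch of step `k` is independent of `θ_k`, so the term linear in `r` has mean
zero, and the off-diagonal terms of `‖r‖²` vanish in the mean, which leaves `O(1/n)`
(`integral_step_le`).

Quasi-Monte Carlo: `r` is a vector of quadrature errors of functions of class `C^d` whose mixed
derivatives are bounded uniformly for `θ ∈ K`. The Koksma-Hlawka inequality (`abs_quadErr_le`) gives
`‖r‖ ≤ C D*`. The linear term no longer cancels, so the final bound is of first order in `D*`.

For blocks of a `(t, d)`-sequence, `D*` is bounded by cutting a box anchored at the origin into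
dyadic boxes along the binary expansions of its sides. Each of the at most `(m + 2)^d` pieces
contributes a counting error of at most `2^t` (`IsNet.abs_boxErr_le`). -/

theorem contDiff_swish {n : WithTop ℕ∞} : ContDiff ℝ n swish := by
  unfold swish
  refine contDiff_id.div (contDiff_const.add (Real.contDiff_exp.comp contDiff_neg)) fun s => ?_
  have := Real.exp_pos (-s)
  positivity

/-! ### Smoothness of the network and of its densities, jointly in `x` and `θ` -/

section PartialGradient

variable {E F : Type*} [NormedAddCommGroup E] [NormedSpace ℝ E] [NormedAddCommGroup F]
  [InnerProductSpace ℝ F] [CompleteSpace F]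

/-- The gradient in the second variable. -/
def gradSnd (h : E × F → ℝ) (p : E × F) : F := gradient (fun y => h (p.1, y)) p.2

theorem contDiff_gradSnd {h : E × F → ℝ} (hh : ContDiff ℝ (⊤ : ℕ∞) h) :
    ContDiff ℝ (⊤ : ℕ∞) (gradSnd h) := by
  unfold gradSnd gradient
  refine (LinearIsometryEquiv.contDiff _).comp ?_
  refine ContDiff.fderiv (f := fun (p : E × F) y => h (p.1, y)) (n := (⊤ : ℕ∞)) ?_ contDiff_snd le_rfl
  exact hh.comp ((contDiff_fst.comp contDiff_fst).prodMk contDiff_snd)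

theorem hasGradientAt_gradSnd {h : E × F → ℝ} (hh : ContDiff ℝ (⊤ : ℕ∞) h) (x : E) (y : F) :
    HasGradientAt (fun y => h (x, y)) (gradSnd h (x, y)) y := by
  refine DifferentiableAt.hasGradientAt ?_
  exact ((hh.comp (contDiff_prodMk_right x)).differentiable (by simp)) y

end PartialGradient

namespace Arch

variable (N : Arch)

theorem contDiff_layer : ∀ (l : ℕ) (h : l ≤ N.depth) (r : Fin (N.width l)),
    ContDiff ℝ (⊤ : ℕ∞) (fun p : Pt N.dim × N.Param => N.layer p.2 p.1 l h r)
  | 0, _, r => by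
    simp only [layer]
    fun_prop
  | l + 1, h, r => by
    have ih := contDiff_layer l (Nat.le_of_succ_le h)
    simp only [layer]
    refine ContDiff.add (ContDiff.sum fun s _ => ContDiff.mul (by fun_prop) ?_) (by fun_prop)
    split_ifs
    · exact ih s
    · exact contDiff_swish.comp (ih s)

theorem contDiff_v : ContDiff ℝ (⊤ : ℕ∞) (fun p : Pt N.dim × N.Param => N.v p.1 p.2) :=
  N.contDiff_layer _ _ _

/-- The Dirichlet energy density of the network. -/
def energy (p : Pt N.dim × N.Param) : ℝ := 1 / 2 * ‖gradient (fun y => N.v y p.2) p.1‖ ^ 2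

theorem contDiff_energy : ContDiff ℝ (⊤ : ℕ∞) N.energy := by
  have h : ContDiff ℝ (⊤ : ℕ∞) (fun p : N.Param × Pt N.dim => N.v p.2 p.1) :=
    N.contDiff_v.comp (contDiff_snd.prodMk contDiff_fst)
  have h2 := (contDiff_gradSnd h).comp
    (contDiff_snd.prodMk contDiff_fst : ContDiff ℝ (⊤ : ℕ∞) (fun p : Pt N.dim × N.Param => (p.2, p.1)))
  exact contDiff_const.mul (h2.norm_sq ℝ)

/-- The potential density of the network for the potential `1`. -/
def mass (p : Pt N.dim × N.Param) : ℝ := 1 / 2 * |N.v p.1 p.2| ^ 2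

theorem contDiff_mass : ContDiff ℝ (⊤ : ℕ∞) N.mass := by
  have : N.mass = fun p => 1 / 2 * (N.v p.1 p.2) ^ 2 := by
    ext p; simp [mass]
  rw [this]
  exact contDiff_const.mul (N.contDiff_v.pow 2)

variable (V g : Pt N.dim → ℝ)

/-- The integrand is affine in the values `V x` and `g x`, with coefficients smooth in `(x, θ)`. All
estimates on compact sets thus need only bounds on `V` and `g`, and differentiation in `θ` asks no
regularity of them. -/
theorem integrand_eq (x : Pt N.dim) (θ : N.Param) :
    N.integrand V g x θ = N.energy (x, θ) - g x * N.v x θ + V x * N.mass (x, θ) := by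
  simp only [integrand, energy, mass]; ring

/-- The gradient in `θ` of the integrand. -/
def gradIntegrand (x : Pt N.dim) (θ : N.Param) : N.Param :=
  gradSnd N.energy (x, θ) - g x • gradSnd (fun p => N.v p.1 p.2) (x, θ)
    + V x • gradSnd N.mass (x, θ)

theorem hasGradientAt_integrand (x : Pt N.dim) (θ : N.Param) :
    HasGradientAt (N.integrand V g x) (N.gradIntegrand V g x θ) θ := by
  have h1 := hasGradientAt_gradSnd N.contDiff_energy x θ
  have h2 := hasGradientAt_gradSnd N.contDiff_v x θ
  have h3 := hasGradientAt_gradSnd N.contDiff_mass x θ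
  have : N.integrand V g x = fun θ => N.energy (x, θ) - g x * N.v x θ + V x * N.mass (x, θ) :=
    funext fun θ => N.integrand_eq V g x θ
  rw [this, hasGradientAt_iff_hasFDerivAt, gradIntegrand]
  rw [hasGradientAt_iff_hasFDerivAt] at h1 h2 h3
  simp only [map_add, map_sub, map_smul]
  exact (h1.sub (h2.const_mul (g x))).add (h3.const_mul (V x))

theorem gradient_empLoss {n : ℕ} (X : Fin n → Pt N.dim) (θ : N.Param) :
    gradient (N.empLoss V g X) θ = (1 / (n : ℝ)) • ∑ j, N.gradIntegrand V g (X j) θ := by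
  apply HasGradientAt.gradient
  rw [hasGradientAt_iff_hasFDerivAt]
  simp only [map_smul, map_sum]
  unfold empLoss
  refine HasFDerivAt.const_mul ?_ _
  refine HasFDerivAt.fun_sum fun j _ => ?_
  exact (N.hasGradientAt_integrand V g (X j) θ).hasFDerivAt

end Arch

/-! ### Boxes, and the uniform law on the cube -/

theorem isCompact_box (ι : Type*) [Fintype ι] (a b : ℝ) :
    IsCompact {x : EuclideanSpace ℝ ι | ∀ i, a ≤ x i ∧ x i ≤ b} := by
  have h : IsCompact (Set.univ.pi fun _ : ι => Set.Icc a b) :=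
    isCompact_univ_pi fun _ => isCompact_Icc
  convert h.image (PiLp.continuous_toLp 2 (fun _ : ι => ℝ)) using 1
  ext x
  simp only [Set.mem_ofPred_eq, Set.mem_image, Set.mem_univ_pi, Set.mem_Icc]
  exact ⟨fun hx => ⟨x.ofLp, hx, rfl⟩, by rintro ⟨y, hy, rfl⟩; exact hy⟩

theorem isCompact_cube (d : ℕ) : IsCompact (cube d) := isCompact_box _ 0 1

theorem convex_box (ι : Type*) [Fintype ι] (a b : ℝ) :
    Convex ℝ {x : EuclideanSpace ℝ ι | ∀ i, a ≤ x i ∧ x i ≤ b} := by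
  intro x hx y hy s t hs ht hst i
  simp only [PiLp.add_apply, PiLp.smul_apply, smul_eq_mul]
  have h1 := hx i
  have h2 := hy i
  constructor
  · calc a = s * a + t * a := by rw [← add_mul, hst, one_mul]
      _ ≤ _ := by gcongr; exacts [h1.1, h2.1]
  · calc _ ≤ s * b + t * b := by gcongr; exacts [h1.2, h2.2]
      _ = b := by rw [← add_mul, hst, one_mul]

theorem convex_cube (d : ℕ) : Convex ℝ (cube d) := convex_box _ 0 1

theorem measurableSet_cube (d : ℕ) : MeasurableSet (cube d) :=
  (isCompact_cube d).isClosed.measurableSet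

theorem cube_eq_preimage (d : ℕ) :
    cube d = (MeasurableEquiv.toLp 2 (Fin d → ℝ)).symm ⁻¹' Set.Icc 0 1 := by
  ext x
  simp [cube, Pi.le_def, forall_and]

theorem volume_cube (d : ℕ) : volume (cube d) = 1 := by
  rw [cube_eq_preimage, (EuclideanSpace.volume_preserving_symm_measurableEquiv_toLp
    (Fin d)).measure_preimage measurableSet_Icc.nullMeasurableSet, Real.volume_Icc_pi]
  simp

instance (d : ℕ) : IsProbabilityMeasure (unif d) :=
  ⟨by rw [unif, Measure.restrict_apply_univ, volume_cube]⟩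

theorem ae_unif_mem_cube (d : ℕ) : ∀ᵐ x ∂(unif d), x ∈ cube d :=
  ae_restrict_mem (measurableSet_cube d)

/-! ### Uniform bounds, and differentiation of the loss under the integral -/

section Bounds

theorem exists_bound_of_isCompact_prod {E F G : Type*} [TopologicalSpace E] [TopologicalSpace F]
    [SeminormedAddCommGroup G] {A : E × F → G} (hA : Continuous A) {S : Set E} {T : Set F}
    (hS : IsCompact S) (hT : IsCompact T) :
    ∃ M, 0 ≤ M ∧ ∀ x ∈ S, ∀ y ∈ T, ‖A (x, y)‖ ≤ M := by
  obtain ⟨M, hM⟩ := (hS.prod hT).exists_bound_of_continuousOn hA.continuousOn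
  exact ⟨max M 0, le_max_right _ _, fun x hx y hy => (hM (x, y) ⟨hx, hy⟩).trans (le_max_left _ _)⟩

variable {E F G : Type*} [NormedAddCommGroup E] [NormedSpace ℝ E] [NormedAddCommGroup F]
  [NormedSpace ℝ F] [NormedAddCommGroup G] [NormedSpace ℝ G]

/-- Mean value inequality along the segment from `(x, z)` to `(x, y)`, with the derivative bounded
on the compact convex set `S × T`. -/
theorem exists_lipschitz_of_isCompact_prod {A : E × F → G} (hA : ContDiff ℝ (⊤ : ℕ∞) A) {S : Set E}
    {T : Set F} (hS : IsCompact S) (hT : IsCompact T) (hSc : Convex ℝ S) (hTc : Convex ℝ T) :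
    ∃ ℓ, 0 ≤ ℓ ∧ ∀ x ∈ S, ∀ y ∈ T, ∀ z ∈ T, ‖A (x, y) - A (x, z)‖ ≤ ℓ * ‖y - z‖ := by
  have hc : Continuous (fderiv ℝ A) := hA.continuous_fderiv (by simp)
  obtain ⟨M, hM0, hM⟩ := exists_bound_of_isCompact_prod hc hS hT
  refine ⟨M, hM0, fun x hx y hy z hz => ?_⟩
  have h := (hSc.prod hTc).norm_image_sub_le_of_norm_fderiv_le (𝕜 := ℝ) (f := A) (C := M)
    (x := (x, z)) (y := (x, y)) (fun p _ => (hA.differentiable (by simp)) p)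
    (fun p hp => hM p.1 hp.1 p.2 hp.2) ⟨hx, hz⟩ ⟨hx, hy⟩
  simpa [Prod.norm_def] using h

end Bounds

namespace Arch

variable (N : Arch)

theorem contDiff_gradSnd_v :
    ContDiff ℝ (⊤ : ℕ∞) (gradSnd (fun p : Pt N.dim × N.Param => N.v p.1 p.2)) :=
  contDiff_gradSnd N.contDiff_v

theorem theta_eq (B : ℝ) : N.Theta B = {θ | ∀ i, -B ≤ θ i ∧ θ i ≤ B} := by
  ext θ; simp [Theta, abs_le]

theorem isCompact_Theta (B : ℝ) : IsCompact (N.Theta B) := by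
  rw [theta_eq]; exact isCompact_box _ _ _

theorem convex_Theta (B : ℝ) : Convex ℝ (N.Theta B) := by
  rw [theta_eq]; exact convex_box _ _ _

theorem exists_bound_gradIntegrand {T : Set N.Param} (hT : IsCompact T) (M₀ : ℝ) :
    ∃ M, 0 ≤ M ∧ ∀ V g : Pt N.dim → ℝ, ∀ x ∈ cube N.dim, |V x| ≤ M₀ → |g x| ≤ M₀ →
      ∀ θ ∈ T, ‖N.gradIntegrand V g x θ‖ ≤ M := by
  obtain ⟨a, ha0, ha⟩ := exists_bound_of_isCompact_prod
    (contDiff_gradSnd N.contDiff_energy).continuous (isCompact_cube _) hT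
  obtain ⟨b, hb0, hb⟩ := exists_bound_of_isCompact_prod
    N.contDiff_gradSnd_v.continuous (isCompact_cube _) hT
  obtain ⟨c, hc0, hc⟩ := exists_bound_of_isCompact_prod
    (contDiff_gradSnd N.contDiff_mass).continuous (isCompact_cube _) hT
  refine ⟨a + |M₀| * b + |M₀| * c, by positivity, fun V g x hx hV hg θ hθ => ?_⟩
  unfold gradIntegrand
  refine (norm_add_le _ _).trans (add_le_add ((norm_sub_le _ _).trans (add_le_add (ha x hx θ hθ) ?_)) ?_)
  · rw [norm_smul, Real.norm_eq_abs]
    exact mul_le_mul (hg.trans (le_abs_self _)) (hb x hx θ hθ) (norm_nonneg _) (abs_nonneg _)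
  · rw [norm_smul, Real.norm_eq_abs]
    exact mul_le_mul (hV.trans (le_abs_self _)) (hc x hx θ hθ) (norm_nonneg _) (abs_nonneg _)

theorem exists_lipschitz_gradIntegrand {T : Set N.Param} (hT : IsCompact T) (hTc : Convex ℝ T)
    (M₀ : ℝ) :
    ∃ ℓ, 0 < ℓ ∧ ∀ V g : Pt N.dim → ℝ, ∀ x ∈ cube N.dim, |V x| ≤ M₀ → |g x| ≤ M₀ →
      ∀ θ ∈ T, ∀ θ' ∈ T,
        ‖N.gradIntegrand V g x θ - N.gradIntegrand V g x θ'‖ ≤ ℓ * ‖θ - θ'‖ := by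
  obtain ⟨a, ha0, ha⟩ := exists_lipschitz_of_isCompact_prod
    (contDiff_gradSnd N.contDiff_energy) (isCompact_cube _) hT (convex_cube _) hTc
  obtain ⟨b, hb0, hb⟩ := exists_lipschitz_of_isCompact_prod
    N.contDiff_gradSnd_v (isCompact_cube _) hT (convex_cube _) hTc
  obtain ⟨c, hc0, hc⟩ := exists_lipschitz_of_isCompact_prod
    (contDiff_gradSnd N.contDiff_mass) (isCompact_cube _) hT (convex_cube _) hTc
  -- The summand `1` only makes the constant strictly positive.
  refine ⟨a + |M₀| * b + |M₀| * c + 1, by positivity, fun V g x hx hV hg θ hθ θ' hθ' => ?_⟩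
  have h1 := ha x hx θ hθ θ' hθ'
  have h2 := hb x hx θ hθ θ' hθ'
  have h3 := hc x hx θ hθ θ' hθ'
  set A := gradSnd N.energy
  set B := gradSnd (fun p : Pt N.dim × N.Param => N.v p.1 p.2)
  set C := gradSnd N.mass
  have e : N.gradIntegrand V g x θ - N.gradIntegrand V g x θ' =
      (A (x, θ) - A (x, θ')) - g x • (B (x, θ) - B (x, θ')) + V x • (C (x, θ) - C (x, θ')) := by
    simp only [gradIntegrand, A, B, C, smul_sub]; abel
  rw [e]
  have h4 : ‖g x • (B (x, θ) - B (x, θ'))‖ ≤ |M₀| * (b * ‖θ - θ'‖) := by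
    rw [norm_smul, Real.norm_eq_abs]
    exact mul_le_mul (hg.trans (le_abs_self _)) h2 (norm_nonneg _) (abs_nonneg _)
  have h5 : ‖V x • (C (x, θ) - C (x, θ'))‖ ≤ |M₀| * (c * ‖θ - θ'‖) := by
    rw [norm_smul, Real.norm_eq_abs]
    exact mul_le_mul (hV.trans (le_abs_self _)) h3 (norm_nonneg _) (abs_nonneg _)
  have h6 := norm_add_le ((A (x, θ) - A (x, θ')) - g x • (B (x, θ) - B (x, θ')))
    (V x • (C (x, θ) - C (x, θ')))
  have h7 := norm_sub_le (A (x, θ) - A (x, θ')) (g x • (B (x, θ) - B (x, θ')))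
  nlinarith [norm_nonneg (θ - θ')]

/-- The coefficients of the equation are measurable and bounded by `M`, almost everywhere. -/
structure IsAEBounded {d : ℕ} (f : Pt d → ℝ) (M : ℝ) : Prop where
  aemeasurable : AEMeasurable f (unif d)
  le : ∀ᵐ x ∂(unif d), |f x| ≤ M

variable {N} {V g : Pt N.dim → ℝ} {M : ℝ}

theorem aestronglyMeasurable_gradIntegrand (hV : IsAEBounded V M) (hg : IsAEBounded g M)
    (θ : N.Param) :
    AEStronglyMeasurable (fun x => N.gradIntegrand V g x θ) (unif N.dim) := by
  have hc : ∀ {A : Pt N.dim × N.Param → N.Param}, ContDiff ℝ (⊤ : ℕ∞) A →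
      AEStronglyMeasurable (fun x => A (x, θ)) (unif N.dim) := fun hA =>
    (hA.continuous.comp (continuous_id.prodMk continuous_const)).aestronglyMeasurable
  unfold gradIntegrand
  exact ((hc (contDiff_gradSnd N.contDiff_energy)).sub
    (hg.aemeasurable.aestronglyMeasurable.smul (hc N.contDiff_gradSnd_v))).add
    (hV.aemeasurable.aestronglyMeasurable.smul (hc (contDiff_gradSnd N.contDiff_mass)))

theorem integrable_gradIntegrand (hV : IsAEBounded V M) (hg : IsAEBounded g M) (θ : N.Param) :
    Integrable (fun x => N.gradIntegrand V g x θ) (unif N.dim) := by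
  obtain ⟨C, -, hC⟩ := N.exists_bound_gradIntegrand (isCompact_singleton (x := θ)) M
  refine Integrable.of_bound (aestronglyMeasurable_gradIntegrand hV hg θ) C ?_
  filter_upwards [ae_unif_mem_cube _, hV.le, hg.le] with x hx h1 h2
  exact hC V g x hx h1 h2 θ rfl

theorem integrable_integrand (hV : IsAEBounded V M) (hg : IsAEBounded g M) (θ : N.Param) :
    Integrable (fun x => N.integrand V g x θ) (unif N.dim) := by
  have hc : ∀ {A : Pt N.dim × N.Param → ℝ}, ContDiff ℝ (⊤ : ℕ∞) A →
      Integrable (fun x => A (x, θ)) (unif N.dim) := fun hA =>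
    (hA.continuous.comp (continuous_id.prodMk continuous_const)).continuousOn.integrableOn_compact
      (isCompact_cube _)
  simp_rw [integrand_eq]
  exact ((hc N.contDiff_energy).sub ((hc N.contDiff_v).bdd_mul
    hg.aemeasurable.aestronglyMeasurable hg.le)).add ((hc N.contDiff_mass).bdd_mul
    hV.aemeasurable.aestronglyMeasurable hV.le)

/-- Dominated differentiation: on the unit ball about `θ` the gradients of the integrand have a
common constant bound, which is integrable because the cube has finite measure. -/
theorem hasGradientAt_loss (hV : IsAEBounded V M) (hg : IsAEBounded g M) (θ : N.Param) :
    HasGradientAt (N.loss V g) (∫ x, N.gradIntegrand V g x θ ∂(unif N.dim)) θ := by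
  obtain ⟨C, -, hC⟩ := N.exists_bound_gradIntegrand (isCompact_closedBall θ 1) M
  rw [hasGradientAt_iff_hasFDerivAt]
  have hint := integrable_gradIntegrand hV hg θ
  have key := hasFDerivAt_integral_of_dominated_of_fderiv_le (μ := unif N.dim) (𝕜 := ℝ)
    (F := fun θ x => N.integrand V g x θ) (x₀ := θ) (bound := fun _ => C)
    (s := Metric.closedBall θ 1)
    (F' := fun θ x => InnerProductSpace.toDual ℝ N.Param (N.gradIntegrand V g x θ))
    (Metric.closedBall_mem_nhds θ one_pos)
    (Eventually.of_forall fun θ' => (integrable_integrand hV hg θ').aestronglyMeasurable)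
    (integrable_integrand hV hg θ)
    ((InnerProductSpace.toDual ℝ N.Param).continuous.comp_aestronglyMeasurable
      hint.aestronglyMeasurable)
    (by
      filter_upwards [ae_unif_mem_cube _, hV.le, hg.le] with x hx h1 h2 θ' hθ'
      rw [LinearIsometryEquiv.norm_map]
      exact hC V g x hx h1 h2 θ' hθ')
    (integrable_const _)
    (Eventually.of_forall fun x θ' _ => (N.hasGradientAt_integrand V g x θ').hasFDerivAt)
  -- Riesz duality commutes with the integral: both functionals are tested against an arbitrary
  -- vector `y`, using the symmetry of the real inner product.
  have e : ∫ x, InnerProductSpace.toDual ℝ N.Param (N.gradIntegrand V g x θ) ∂(unif N.dim) =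
      InnerProductSpace.toDual ℝ N.Param (∫ x, N.gradIntegrand V g x θ ∂(unif N.dim)) := by
    ext y
    have hi : Integrable (fun x => InnerProductSpace.toDual ℝ N.Param (N.gradIntegrand V g x θ))
        (unif N.dim) := by
      refine ⟨(InnerProductSpace.toDual ℝ N.Param).continuous.comp_aestronglyMeasurable
        hint.aestronglyMeasurable, ?_⟩
      exact hint.2.congr' (Eventually.of_forall fun x => by simp)
    rw [ContinuousLinearMap.integral_apply hi, InnerProductSpace.toDual_apply_apply,
      real_inner_comm, ← integral_inner hint]
    simp only [InnerProductSpace.toDual_apply_apply, real_inner_comm]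
  rw [e] at key
  exact key

theorem gradient_loss (hV : IsAEBounded V M) (hg : IsAEBounded g M) (θ : N.Param) :
    gradient (N.loss V g) θ = ∫ x, N.gradIntegrand V g x θ ∂(unif N.dim) :=
  (hasGradientAt_loss hV hg θ).gradient

theorem continuous_loss (hV : IsAEBounded V M) (hg : IsAEBounded g M) :
    Continuous (N.loss V g) :=
  continuous_iff_continuousAt.2 fun θ => (hasGradientAt_loss hV hg θ).continuousAt

theorem exists_gradLipschitzOn (hV : IsAEBounded V M) (hg : IsAEBounded g M)
    {T : Set N.Param} (hT : IsCompact T) (hTc : Convex ℝ T) :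
    ∃ ℓ, 0 < ℓ ∧ N.GradLipschitzOn V g T ℓ := by
  obtain ⟨ℓ, hℓ0, hℓ⟩ := N.exists_lipschitz_gradIntegrand hT hTc M
  refine ⟨ℓ, hℓ0, fun θ hθ θ' hθ' => ?_⟩
  rw [gradient_loss hV hg, gradient_loss hV hg, ← integral_sub (integrable_gradIntegrand hV hg θ)
    (integrable_gradIntegrand hV hg θ')]
  have := norm_integral_le_of_norm_le_const (μ := unif N.dim)
    (f := fun x => N.gradIntegrand V g x θ - N.gradIntegrand V g x θ') (C := ℓ * ‖θ - θ'‖) (by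
      filter_upwards [ae_unif_mem_cube _, hV.le, hg.le] with x hx h1 h2
      exact hℓ V g x hx h1 h2 θ hθ θ' hθ')
  simpa using this

theorem continuous_gradient_loss (hV : IsAEBounded V M) (hg : IsAEBounded g M) :
    Continuous (gradient (N.loss V g)) := by
  refine continuous_iff_continuousAt.2 fun θ => ?_
  obtain ⟨ℓ, hℓ0, hℓ⟩ := exists_gradLipschitzOn hV hg (isCompact_closedBall θ 1)
    (convex_closedBall θ 1)
  have h : LipschitzOnWith ⟨ℓ, hℓ0.le⟩ (gradient (N.loss V g)) (Metric.closedBall θ 1) :=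
    LipschitzOnWith.of_dist_le_mul fun x hx y hy => by
      rw [dist_eq_norm, dist_eq_norm]; exact hℓ x hx y hy
  exact h.continuousOn.continuousAt (Metric.closedBall_mem_nhds θ one_pos)

end Arch

/-! ### Gradient descent with an error in the gradient -/

/-- The Polyak-Łojasiewicz inequality for strongly convex functions. -/
theorem sub_le_norm_sq_of_stronglyConvex {E : Type*} [NormedAddCommGroup E]
    [InnerProductSpace ℝ E] {f : E → ℝ} {f' : E → E} {c : ℝ} (hc : 0 < c) {x y : E}
    (h : f x + inner ℝ (f' x) (y - x) + c / 2 * ‖y - x‖ ^ 2 ≤ f y) :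
    2 * c * (f x - f y) ≤ ‖f' x‖ ^ 2 := by
  -- Completing the square: expanded, this is the strong convexity inequality multiplied by `2c`,
  -- after the term in `f y - f x` is inserted.
  have h1 : 0 ≤ ‖f' x + c • (y - x)‖ ^ 2 := by positivity
  rw [norm_add_sq_real, real_inner_smul_right, norm_smul, Real.norm_of_nonneg hc.le] at h1
  nlinarith

section Descent

variable {E : Type*} [NormedAddCommGroup E] [InnerProductSpace ℝ E] [CompleteSpace E]
  {f : E → ℝ} {f' : E → E} {K : Set E} {L c α : ℝ}

/-- The descent lemma. -/
theorem le_add_inner_add_sq_of_lipschitz (hf : ∀ x, HasGradientAt f (f' x) x) (hK : Convex ℝ K)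
    (hL : ∀ x ∈ K, ∀ y ∈ K, ‖f' x - f' y‖ ≤ L * ‖x - y‖) {x y : E} (hx : x ∈ K) (hy : y ∈ K) :
    f y ≤ f x + inner ℝ (f' x) (y - x) + L / 2 * ‖y - x‖ ^ 2 := by
  -- Gap, along the segment, between `f` and its quadratic upper model, up to the constant `f x`.
  -- The Lipschitz bound makes its derivative nonpositive, and comparing the values at `0` and `1`
  -- gives the claim.
  set φ : ℝ → ℝ := fun t => f (x + t • (y - x)) - t * inner ℝ (f' x) (y - x)
    - t ^ 2 * (L / 2 * ‖y - x‖ ^ 2) with hφ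
  have hd : ∀ t, HasDerivAt φ (inner ℝ (f' (x + t • (y - x))) (y - x) - inner ℝ (f' x) (y - x)
      - 2 * t * (L / 2 * ‖y - x‖ ^ 2)) t := fun t => by
    have h1 : HasDerivAt (fun t : ℝ => x + t • (y - x)) (y - x) t := by
      simpa using ((hasDerivAt_id t).smul_const (y - x)).const_add x
    have h2 := (hf (x + t • (y - x))).hasFDerivAt.comp_hasDerivAt t h1
    have h3 := (hasDerivAt_id t).mul_const (inner ℝ (f' x) (y - x))
    have h4 := ((hasDerivAt_id t).pow 2).mul_const (L / 2 * ‖y - x‖ ^ 2)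
    exact ((h2.sub h3).sub h4).congr_deriv (by simp)
  have hanti : AntitoneOn φ (Set.Icc 0 1) := by
    refine antitoneOn_of_deriv_nonpos (convex_Icc 0 1)
      (fun t _ => (hd t).continuousAt.continuousWithinAt)
      (fun t _ => (hd t).differentiableAt.differentiableWithinAt) fun t ht => ?_
    rw [interior_Icc] at ht
    rw [(hd t).deriv, ← inner_sub_left]
    have hz : x + t • (y - x) ∈ K := hK.add_smul_sub_mem hx hy ⟨ht.1.le, ht.2.le⟩
    have h1 := real_inner_le_norm (f' (x + t • (y - x)) - f' x) (y - x)
    have h2 := hL _ hz _ hx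
    rw [add_sub_cancel_left, norm_smul, Real.norm_of_nonneg ht.1.le] at h2
    have h3 := mul_le_mul_of_nonneg_right h2 (norm_nonneg (y - x))
    nlinarith
  have h := hanti (Set.left_mem_Icc.2 zero_le_one) (Set.right_mem_Icc.2 zero_le_one) zero_le_one
  simp only [hφ, zero_smul, one_smul, add_zero, add_sub_cancel] at h
  linarith

/-- One step of gradient descent with error `r`. -/
theorem step_bound (hf : ∀ x, HasGradientAt f (f' x) x) (hK : Convex ℝ K)
    (hL : ∀ x ∈ K, ∀ y ∈ K, ‖f' x - f' y‖ ≤ L * ‖x - y‖) (hc : 0 < c)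
    (hsc : ∀ x ∈ K, ∀ y ∈ K, f x + inner ℝ (f' x) (y - x) + c / 2 * ‖y - x‖ ^ 2 ≤ f y)
    (hα : 0 < α) (hαL : α * L < 2) {x z g : E} (hx : x ∈ K) (hz : z ∈ K)
    (hstep : x - α • g ∈ K) :
    f (x - α • g) - f z ≤ (1 - 2 * c * α * (1 - α * L / 2)) * (f x - f z)
      + (α ^ 2 * L - α) * inner ℝ (f' x) (g - f' x) + α ^ 2 * L / 2 * ‖g - f' x‖ ^ 2 := by
  have h1 := le_add_inner_add_sq_of_lipschitz hf hK hL hx hstep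
  have h2 := sub_le_norm_sq_of_stronglyConvex hc (hsc x hx z hz)
  obtain ⟨r, rfl⟩ : ∃ r, g = f' x + r := ⟨g - f' x, by abel⟩
  rw [sub_sub_cancel_left, inner_neg_right, real_inner_smul_right, norm_neg, norm_smul,
    Real.norm_of_nonneg hα.le, mul_pow, inner_add_right, norm_add_sq_real,
    real_inner_self_eq_norm_sq] at h1
  rw [add_sub_cancel_left]
  -- In the expanded descent lemma `‖f' x‖²` has the coefficient `-α(1 - αL/2)`. It is nonpositive
  -- because `αL < 2`, so the Polyak-Łojasiewicz bound may be inserted.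
  have h3 := mul_le_mul_of_nonneg_left h2 (show 0 ≤ α * (1 - α * L / 2) by
    apply mul_nonneg hα.le; linarith)
  nlinarith

theorem contraction_mem (hα : 0 < α) (hαL : α * L < 2) (hc : 0 < c) (hcL : c < L) :
    0 ≤ 1 - 2 * c * α * (1 - α * L / 2) ∧ 1 - 2 * c * α * (1 - α * L / 2) < 1 := by
  have h1 : 0 < c * α * (1 - α * L / 2) := by
    have : 0 < 1 - α * L / 2 := by linarith
    positivity
  refine ⟨?_, by linarith⟩
  have h2 : 0 ≤ α * (1 - α * L / 2) := by
    apply mul_nonneg hα.le; linarith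
  -- Replacing `c` by the larger `L` lowers the factor to `(1 - αL)²`, which is nonnegative.
  nlinarith [mul_le_mul_of_nonneg_right hcL.le h2, sq_nonneg (α * L - 1)]

end Descent

/-- The fixed point of `u ↦ q u + e` is `e / (1 - q)`, and the excess over it decays at least like
`q ^ k`. The limsup is taken in `EReal`, so that `u` need not be bounded below. -/
theorem limsup_le_of_le_mul_add {u : ℕ → ℝ} {q e : ℝ} (hq0 : 0 ≤ q) (hq1 : q < 1)
    (hu : ∀ k, u (k + 1) ≤ q * u k + e) :
    limsup (fun k => (u k : EReal)) atTop ≤ ((e / (1 - q) : ℝ) : EReal) := by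
  have hq : 0 < 1 - q := by linarith
  have h1 : ∀ k, u k ≤ q ^ k * (u 0 - e / (1 - q)) + e / (1 - q) := by
    intro k
    induction k with
    | zero => simp
    | succ k ih =>
      refine (hu k).trans ?_
      have h2 := mul_le_mul_of_nonneg_left ih hq0
      have h3 : q * (e / (1 - q)) + e = e / (1 - q) := by field_simp; ring
      rw [pow_succ]
      linarith
  have h2 : Tendsto (fun k => q ^ k * (u 0 - e / (1 - q)) + e / (1 - q)) atTop
      (nhds (e / (1 - q))) := by
    simpa using ((tendsto_pow_atTop_nhds_zero_of_lt_one hq0 hq1).mul_const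
      (u 0 - e / (1 - q))).add_const (e / (1 - q))
  rw [← ((continuous_coe_real_ereal.tendsto _).comp h2).limsup_eq]
  exact limsup_le_limsup (Eventually.of_forall fun k => EReal.coe_le_coe_iff.2 (h1 k))

/-! ### Mean and variance of the mini-batch gradient error -/

section Sampling

variable {S : Type*} [MeasurableSpace S] {μ : Measure S} [IsProbabilityMeasure μ]
  {𝒳 : Type*} [MeasurableSpace 𝒳] {P : Measure 𝒳}
  {E : Type*} [NormedAddCommGroup E] [InnerProductSpace ℝ E] [CompleteSpace E]
  [MeasurableSpace E] [BorelSpace E] [SecondCountableTopology E]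

/-- By independence the joint law is a product, and Fubini integrates the fresh sample first, with
`z` frozen. -/
theorem integral_eq_zero_of_indepFun {𝒵 : Type*} [MeasurableSpace 𝒵] {Z : S → 𝒵} {Y : S → 𝒳}
    (hZ : Measurable Z) (hY : Measurable Y) (h : IndepFun Z Y μ) {H : 𝒵 × 𝒳 → ℝ}
    (hH : Measurable H) (h0 : ∀ z, ∫ x, H (z, x) ∂(μ.map Y) = 0) :
    ∫ s, H (Z s, Y s) ∂μ = 0 := by
  have := Measure.isProbabilityMeasure_map (μ := μ) hZ.aemeasurable
  have := Measure.isProbabilityMeasure_map (μ := μ) hY.aemeasurable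
  rw [← integral_map (f := H) (φ := fun s => (Z s, Y s)) (hZ.prodMk hY).aemeasurable
    hH.aestronglyMeasurable,
    (indepFun_iff_map_prod_eq_prod_map_map hZ.aemeasurable hY.aemeasurable).1 h]
  by_cases hi : Integrable H ((μ.map Z).prod (μ.map Y))
  · rw [integral_prod H hi]; simp [h0]
  -- Without integrability the Bochner integral is zero by convention, so the claim still holds.
  · exact integral_undef hi

variable {n : ℕ} {ϑ : S → E} {ξ : Fin n → S → 𝒳} {D : 𝒳 → E → E} {m : E → E} {M : ℝ}

theorem integral_inner_average_eq_zero (hϑ : Measurable ϑ) (hξ : ∀ j, Measurable (ξ j))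
    (hlaw : ∀ j, μ.map (ξ j) = P) (hind : ∀ j, IndepFun ϑ (ξ j) μ)
    (hD : Measurable (Function.uncurry D)) (hDi : ∀ θ, Integrable (fun x => D x θ) P)
    (hD0 : ∀ θ, ∫ x, D x θ ∂P = 0) (hm : Measurable m) {M' : ℝ}
    (hmb : ∀ᵐ s ∂μ, ‖m (ϑ s)‖ ≤ M') (hDb : ∀ᵐ s ∂μ, ∀ j, ‖D (ξ j s) (ϑ s)‖ ≤ M) :
    ∫ s, inner ℝ (m (ϑ s)) ((1 / (n : ℝ)) • ∑ j, D (ξ j s) (ϑ s)) ∂μ = 0 := by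
  have hmeas : ∀ j, Measurable fun s => D (ξ j s) (ϑ s) := fun j =>
    hD.comp ((hξ j).prodMk hϑ)
  simp_rw [real_inner_smul_right, inner_sum]
  rw [integral_const_mul, integral_finsetSum]
  · rw [Finset.sum_eq_zero, mul_zero]
    intro j _
    refine integral_eq_zero_of_indepFun (H := fun p : E × 𝒳 => inner ℝ (m p.1) (D p.2 p.1)) hϑ
      (hξ j) (hind j) ?_ fun θ => ?_
    · exact (hm.comp measurable_fst).inner
        (hD.comp (measurable_snd.prodMk measurable_fst))
    · dsimp only
      rw [hlaw j, integral_inner (hDi θ), hD0, inner_zero_right]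
  · intro j _
    refine Integrable.of_bound ((hm.comp hϑ).inner (hmeas j)).aestronglyMeasurable (M' * M) ?_
    filter_upwards [hmb, hDb] with s h1 h2
    exact (norm_inner_le_norm _ _).trans
      (mul_le_mul h1 (h2 j) (norm_nonneg _) ((norm_nonneg _).trans h1))

/-- Expand the square as a double sum. For `j ≠ l` the term has mean zero once `(ϑ, ξ j)` is frozen,
which is why independence is asked of that pair and not of `ϑ` alone. The `n` diagonal terms are at
most `M²` each, against the prefactor `1/n²`. -/
theorem integral_norm_sq_average_le (hn : 1 ≤ n) (hϑ : Measurable ϑ) (hξ : ∀ j, Measurable (ξ j))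
    (hlaw : ∀ j, μ.map (ξ j) = P)
    (hind : ∀ j l, j ≠ l → IndepFun (fun s => (ϑ s, ξ j s)) (ξ l) μ)
    (hD : Measurable (Function.uncurry D)) (hDi : ∀ θ, Integrable (fun x => D x θ) P)
    (hD0 : ∀ θ, ∫ x, D x θ ∂P = 0) (hDb : ∀ᵐ s ∂μ, ∀ j, ‖D (ξ j s) (ϑ s)‖ ≤ M) :
    ∫ s, ‖(1 / (n : ℝ)) • ∑ j, D (ξ j s) (ϑ s)‖ ^ 2 ∂μ ≤ M ^ 2 / n := by
  have hn' : (0 : ℝ) < n := by exact_mod_cast hn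
  have hmeas : ∀ j, Measurable fun s => D (ξ j s) (ϑ s) := fun j =>
    hD.comp ((hξ j).prodMk hϑ)
  have hint : ∀ j l, Integrable
      (fun s => inner ℝ (D (ξ j s) (ϑ s)) (D (ξ l s) (ϑ s))) μ := fun j l => by
    refine Integrable.of_bound ((hmeas j).inner (hmeas l)).aestronglyMeasurable (M * M) ?_
    filter_upwards [hDb] with s h2
    exact (norm_inner_le_norm _ _).trans
      (mul_le_mul (h2 j) (h2 l) (norm_nonneg _) ((norm_nonneg _).trans (h2 j)))
  have e : ∀ s, ‖(1 / (n : ℝ)) • ∑ j, D (ξ j s) (ϑ s)‖ ^ 2 =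
      (1 / (n : ℝ)) ^ 2 * ∑ j, ∑ l, inner ℝ (D (ξ j s) (ϑ s)) (D (ξ l s) (ϑ s)) := fun s => by
    rw [norm_smul, mul_pow, Real.norm_eq_abs, sq_abs, ← real_inner_self_eq_norm_sq, sum_inner]
    simp_rw [inner_sum]
  simp_rw [e]
  rw [integral_const_mul, integral_finsetSum _ fun j _ => integrable_finsetSum _ fun l _ => hint j l]
  have h1 : ∀ j, ∫ s, ∑ l, inner ℝ (D (ξ j s) (ϑ s)) (D (ξ l s) (ϑ s)) ∂μ ≤ M ^ 2 := fun j => by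
    rw [integral_finsetSum _ fun l _ => hint j l, Finset.sum_eq_single j]
    · have := integral_mono_ae (hint j j) (integrable_const (M ^ 2)) (by
        filter_upwards [hDb] with s hs
        rw [real_inner_self_eq_norm_sq]
        exact pow_le_pow_left₀ (norm_nonneg _) (hs j) 2)
      simpa using this
    · intro l _ hl
      refine integral_eq_zero_of_indepFun
        (H := fun p : (E × 𝒳) × 𝒳 => inner ℝ (D p.1.2 p.1.1) (D p.2 p.1.1)) (hϑ.prodMk (hξ j))
        (hξ l) (hind j l hl.symm) ?_ fun z => ?_
      · exact (hD.comp ((measurable_snd.comp measurable_fst).prodMk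
          (measurable_fst.comp measurable_fst))).inner
          (hD.comp (measurable_snd.prodMk (measurable_fst.comp measurable_fst)))
      · dsimp only
        rw [hlaw l, integral_inner (hDi z.1), hD0, inner_zero_right]
    · simp
  have h2 := Finset.sum_le_sum fun (j : Fin n) (_ : j ∈ Finset.univ) => h1 j
  rw [Finset.sum_const, Finset.card_univ, Fintype.card_fin, nsmul_eq_mul] at h2
  calc _ ≤ (1 / (n : ℝ)) ^ 2 * (n * M ^ 2) := by gcongr
    _ = M ^ 2 / n := by field_simp

variable {f : E → ℝ} {f' : E → E} {K : Set E} {L c α : ℝ} {G : 𝒳 → E → E}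

/-- One step of stochastic gradient descent, in expectation. -/
theorem integral_step_le [IsProbabilityMeasure P] (hf : ∀ x, HasGradientAt f (f' x) x)
    (hf' : Measurable f')
    (hK : Convex ℝ K) (hKc : IsCompact K)
    (hL : ∀ x ∈ K, ∀ y ∈ K, ‖f' x - f' y‖ ≤ L * ‖x - y‖) (hc : 0 < c)
    (hsc : ∀ x ∈ K, ∀ y ∈ K, f x + inner ℝ (f' x) (y - x) + c / 2 * ‖y - x‖ ^ 2 ≤ f y)
    (hα : 0 < α) (hL0 : 0 < L) (hαL : α * L < 2) (hG : Measurable (Function.uncurry G))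
    (hGi : ∀ θ, Integrable (fun x => G x θ) P) (hmean : ∀ θ, ∫ x, G x θ ∂P = f' θ)
    (hGb : ∀ᵐ x ∂P, ∀ θ ∈ K, ‖G x θ‖ ≤ M) (hn : 1 ≤ n) (hϑ : Measurable ϑ)
    (hξ : ∀ j, Measurable (ξ j)) (hlaw : ∀ j, μ.map (ξ j) = P)
    (hind₁ : ∀ j, IndepFun ϑ (ξ j) μ)
    (hind₂ : ∀ j l, j ≠ l → IndepFun (fun s => (ϑ s, ξ j s)) (ξ l) μ)
    (hϑK : ∀ᵐ s ∂μ, ϑ s ∈ K)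
    (hϑK' : ∀ᵐ s ∂μ, ϑ s - α • (1 / (n : ℝ)) • ∑ j, G (ξ j s) (ϑ s) ∈ K) {z : E} (hz : z ∈ K) :
    ∫ s, (f (ϑ s - α • (1 / (n : ℝ)) • ∑ j, G (ξ j s) (ϑ s)) - f z) ∂μ ≤
      (1 - 2 * c * α * (1 - α * L / 2)) * ∫ s, (f (ϑ s) - f z) ∂μ
        + α ^ 2 * L / 2 * ((2 * M) ^ 2 / n) := by
  have hn' : (n : ℝ) ≠ 0 := by positivity
  have hfc : Continuous f := continuous_iff_continuousAt.2 fun x => (hf x).continuousAt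
  have hf'b : ∀ θ ∈ K, ‖f' θ‖ ≤ M := fun θ hθ => by
    have := norm_integral_le_of_norm_le_const (μ := P) (f := fun x => G x θ) (C := M) (by
      filter_upwards [hGb] with x hx using hx θ hθ)
    simpa [hmean θ] using this
  set D : 𝒳 → E → E := fun x θ => G x θ - f' θ with hDdef
  have hD : Measurable (Function.uncurry D) := hG.sub (hf'.comp measurable_snd)
  have hDi : ∀ θ, Integrable (fun x => D x θ) P := fun θ => (hGi θ).sub (integrable_const _)
  have hD0 : ∀ θ, ∫ x, D x θ ∂P = 0 := fun θ => by
    simp [hDdef, integral_sub (hGi θ) (integrable_const _), hmean]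
  -- The constant `2M` is `M` for the sampled gradient plus `M` for its mean.
  have hDb : ∀ᵐ s ∂μ, ∀ j, ‖D (ξ j s) (ϑ s)‖ ≤ 2 * M := by
    rw [ae_all_iff]
    intro j
    have h1 : ∀ᵐ s ∂μ, ∀ θ ∈ K, ‖G (ξ j s) θ‖ ≤ M :=
      ae_of_ae_map (hξ j).aemeasurable (by rw [hlaw j]; exact hGb)
    filter_upwards [h1, hϑK] with s h1 h2
    have := norm_sub_le (G (ξ j s) (ϑ s)) (f' (ϑ s))
    linarith [h1 _ h2, hf'b _ h2]
  set r : S → E := fun s => (1 / (n : ℝ)) • ∑ j, D (ξ j s) (ϑ s) with hr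
  have hmeas : ∀ j, Measurable fun s => D (ξ j s) (ϑ s) := fun j =>
    hD.comp ((hξ j).prodMk hϑ)
  have hrm : Measurable r := by
    rw [hr]
    exact (Finset.measurable_fun_sum _ fun j _ => hmeas j).const_smul (1 / (n : ℝ))
  have hrb : ∀ᵐ s ∂μ, ‖r s‖ ≤ 2 * M := by
    filter_upwards [hDb] with s hs
    rw [hr, norm_smul, Real.norm_of_nonneg (by positivity)]
    have := norm_sum_le_of_le Finset.univ fun j _ => hs j
    rw [Finset.sum_const, Finset.card_univ, Fintype.card_fin, nsmul_eq_mul] at this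
    calc _ ≤ 1 / (n : ℝ) * (n * (2 * M)) := by gcongr
      _ = 2 * M := by field_simp
  have hGr : ∀ s, (1 / (n : ℝ)) • ∑ j, G (ξ j s) (ϑ s) = f' (ϑ s) + r s := fun s => by
    simp only [hr, hDdef, Finset.sum_sub_distrib, Finset.sum_const, Finset.card_univ,
      Fintype.card_fin, smul_sub, ← Nat.cast_smul_eq_nsmul ℝ, smul_smul]
    rw [one_div_mul_cancel hn', one_smul]
    abel
  simp_rw [hGr] at hϑK' ⊢
  obtain ⟨Cf, hCf⟩ := hKc.exists_bound_of_continuousOn hfc.continuousOn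
  have hint : ∀ {τ : S → E}, Measurable τ → (∀ᵐ s ∂μ, τ s ∈ K) →
      Integrable (fun s => f (τ s) - f z) μ := fun hτ hτK => by
    refine (Integrable.of_bound (hfc.measurable.comp hτ).aestronglyMeasurable Cf ?_).sub
      (integrable_const _)
    filter_upwards [hτK] with s hs using hCf _ hs
  have hi1 := hint hϑ hϑK
  have hi2 := hint (hϑ.sub (((hf'.comp hϑ).add hrm).const_smul α)) hϑK'
  have hi3 : Integrable (fun s => inner ℝ (f' (ϑ s)) (r s)) μ := by
    refine Integrable.of_bound ((hf'.comp hϑ).inner hrm).aestronglyMeasurable (M * (2 * M)) ?_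
    filter_upwards [hϑK, hrb] with s h1 h2
    exact (norm_inner_le_norm _ _).trans (mul_le_mul (hf'b _ h1) h2 (norm_nonneg _)
      ((norm_nonneg _).trans (hf'b _ h1)))
  have hi4 : Integrable (fun s => ‖r s‖ ^ 2) μ := by
    refine Integrable.of_bound (hrm.norm.pow_const 2).aestronglyMeasurable ((2 * M) ^ 2) ?_
    filter_upwards [hrb] with s h2
    rw [norm_pow, norm_norm]
    exact pow_le_pow_left₀ (norm_nonneg _) h2 2
  have h3 : ∫ s, inner ℝ (f' (ϑ s)) (r s) ∂μ = 0 :=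
    integral_inner_average_eq_zero hϑ hξ hlaw hind₁ hD hDi hD0 hf' (M' := M)
      (by filter_upwards [hϑK] with s hs using hf'b _ hs) hDb
  have h4 : ∫ s, ‖r s‖ ^ 2 ∂μ ≤ (2 * M) ^ 2 / n :=
    integral_norm_sq_average_le hn hϑ hξ hlaw hind₂ hD hDi hD0 hDb
  have key := integral_mono_ae hi2 (((hi1.const_mul (1 - 2 * c * α * (1 - α * L / 2))).add
    (hi3.const_mul (α ^ 2 * L - α))).add (hi4.const_mul (α ^ 2 * L / 2))) (by
      filter_upwards [hϑK, hϑK'] with s h1 h2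
      have := step_bound hf hK hL hc hsc hα hαL h1 hz h2
      simpa using this)
  refine key.trans ?_
  rw [integral_add' ((hi1.const_mul _).add (hi3.const_mul _)) (hi4.const_mul _),
    integral_add' (hi1.const_mul _) (hi3.const_mul _), integral_const_mul, integral_const_mul,
    integral_const_mul, h3, mul_zero, add_zero]
  gcongr

end Sampling

/-! ### Independence of the current iterate from the fresh mini-batch -/

section Iterates

variable {S : Type*} {𝒳 : Type*} [MeasurableSpace 𝒳]
  {E : Type*} [NormedAddCommGroup E] [InnerProductSpace ℝ E]
  [MeasurableSpace E] [BorelSpace E] [SecondCountableTopology E]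
  {n : ℕ} {G : 𝒳 → E → E} {α : ℝ}

theorem measurable_step {_ : MeasurableSpace S} (hG : Measurable (Function.uncurry G)) {ϑ : S → E}
    {ξ : Fin n → S → 𝒳} (hϑ : Measurable ϑ) (hξ : ∀ j, Measurable (ξ j)) :
    Measurable fun s => ϑ s - α • (1 / (n : ℝ)) • ∑ j, G (ξ j s) (ϑ s) :=
  hϑ.sub (((Finset.measurable_fun_sum _ fun j _ =>
    hG.comp ((hξ j).prodMk hϑ)).const_smul (1 / (n : ℝ))).const_smul α)

variable {ϑ : ℕ → S → E} {θ₀ : E} {X : ℕ → Fin n → S → 𝒳}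

/-- The `k`-th iterate is a function of the batches `0, …, k - 1` only. The inequality `p.1 < k` is
strict since batch `k` is used in the step from `k` to `k + 1`. -/
theorem measurable_iterate (hG : Measurable (Function.uncurry G)) (h0 : ∀ s, ϑ 0 s = θ₀)
    (hstep : ∀ k s, ϑ (k + 1) s = ϑ k s - α • (1 / (n : ℝ)) • ∑ j, G (X k j s) (ϑ k s)) (k : ℕ) :
    Measurable[⨆ p ∈ {p : ℕ × Fin n | p.1 < k}, MeasurableSpace.comap (X p.1 p.2) inferInstance]
      (ϑ k) := by
  induction k with
  | zero =>
    have : ϑ 0 = fun _ => θ₀ := funext h0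
    rw [this]; exact measurable_const
  | succ k ih =>
    rw [show ϑ (k + 1) = _ from funext (hstep k)]
    refine measurable_step hG (ih.mono ?_ le_rfl) fun j => ?_
    · exact biSup_mono fun p (hp : p.1 < k) => Nat.lt_succ_of_lt hp
    · exact (comap_measurable (X k j)).mono
        (le_iSup₂_of_le (f := fun (p : ℕ × Fin n) (_ : p ∈ {p : ℕ × Fin n | p.1 < k + 1}) =>
          MeasurableSpace.comap (X p.1 p.2) inferInstance) (k, j) (Nat.lt_succ_self k) le_rfl)
        le_rfl

variable [MeasurableSpace S] {μ : Measure S}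

theorem indepFun_of_measurable_iSup {ι 𝒵 : Type*} [MeasurableSpace 𝒵] {Y : ι → S → 𝒳}
    (hY : ∀ i, Measurable (Y i)) (hind : iIndepFun Y μ) {T : Set ι} {i : ι} (hi : i ∉ T)
    {Z : S → 𝒵} (hZ : Measurable[⨆ p ∈ T, MeasurableSpace.comap (Y p) inferInstance] Z) :
    IndepFun Z (Y i) μ := by
  have h1 := indep_iSup_of_disjoint
    (m := fun p => MeasurableSpace.comap (Y p) inferInstance)
    (fun p => (hY p).comap_le) hind.iIndep (S := T) (T := {i}) (by simpa using hi)
  have h2 : (⨆ p ∈ ({i} : Set ι), MeasurableSpace.comap (Y p) inferInstance)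
      = MeasurableSpace.comap (Y i) inferInstance := by simp
  rw [h2] at h1
  rw [IndepFun_iff_Indep]
  exact indep_of_indep_of_le_left h1 (measurable_iff_comap_le.1 hZ)

theorem indepFun_iterate (hG : Measurable (Function.uncurry G)) (h0 : ∀ s, ϑ 0 s = θ₀)
    (hstep : ∀ k s, ϑ (k + 1) s = ϑ k s - α • (1 / (n : ℝ)) • ∑ j, G (X k j s) (ϑ k s))
    (hX : ∀ k j, Measurable (X k j)) (hind : iIndepFun (fun p : ℕ × Fin n => X p.1 p.2) μ)
    (k : ℕ) {j l : Fin n} (hjl : j ≠ l) :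
    IndepFun (fun s => (ϑ k s, X k j s)) (X k l) μ := by
  -- The past batches together with the single sample `(k, j)` generate a σ-algebra independent of
  -- sample `(k, l)`.
  refine indepFun_of_measurable_iSup (Y := fun p : ℕ × Fin n => X p.1 p.2)
    (fun p => hX p.1 p.2) hind (T := {p | p.1 < k} ∪ {(k, j)}) (i := (k, l))
    (by simp [hjl.symm]) ?_
  refine Measurable.prodMk ((measurable_iterate hG h0 hstep k).mono ?_ le_rfl) ?_
  · exact biSup_mono fun p hp => Or.inl hp
  · exact (comap_measurable (X k j)).mono
      (le_iSup₂_of_le (f := fun (p : ℕ × Fin n)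
        (_ : p ∈ ({p | p.1 < k} ∪ {(k, j)} : Set (ℕ × Fin n))) =>
        MeasurableSpace.comap (X p.1 p.2) inferInstance) (k, j) (Or.inr rfl) le_rfl)
      le_rfl

theorem indepFun_iterate_sample (hG : Measurable (Function.uncurry G)) (h0 : ∀ s, ϑ 0 s = θ₀)
    (hstep : ∀ k s, ϑ (k + 1) s = ϑ k s - α • (1 / (n : ℝ)) • ∑ j, G (X k j s) (ϑ k s))
    (hX : ∀ k j, Measurable (X k j)) (hind : iIndepFun (fun p : ℕ × Fin n => X p.1 p.2) μ)
    (k : ℕ) (l : Fin n) :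
    IndepFun (ϑ k) (X k l) μ :=
  indepFun_of_measurable_iSup (Y := fun p : ℕ × Fin n => X p.1 p.2)
    (fun p => hX p.1 p.2) hind (T := {p | p.1 < k}) (i := (k, l)) (by simp)
    (measurable_iterate hG h0 hstep k)

end Iterates

/-! ### The Monte Carlo bound for the Ritz loss -/

namespace Arch

variable {N : Arch} {V g V' g' : Pt N.dim → ℝ} {M₀ : ℝ}

theorem measurable_gradIntegrand (hV : Measurable V) (hg : Measurable g) :
    Measurable (Function.uncurry (N.gradIntegrand V g)) := by
  have h1 := (contDiff_gradSnd N.contDiff_energy).continuous.measurable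
  have h2 := N.contDiff_gradSnd_v.continuous.measurable
  have h3 := (contDiff_gradSnd N.contDiff_mass).continuous.measurable
  exact (h1.sub ((hg.comp measurable_fst).smul h2)).add ((hV.comp measurable_fst).smul h3)

theorem iter_succ (α : ℝ) (θ₀ : N.Param) {n : ℕ} (X : ℕ → Fin n → Pt N.dim) (k : ℕ) :
    N.iter V g α θ₀ X (k + 1) = N.iter V g α θ₀ X k
      - α • (1 / (n : ℝ)) • ∑ j, N.gradIntegrand V g (X k j) (N.iter V g α θ₀ X k) := by
  rw [iter, gradient_empLoss]

theorem loss_congr (hV : V =ᵐ[unif N.dim] V') (hg : g =ᵐ[unif N.dim] g') :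
    N.loss V g = N.loss V' g' := by
  funext θ
  refine integral_congr_ae ?_
  filter_upwards [hV, hg] with x h1 h2
  simp only [integrand, h1, h2]

theorem iter_congr (α : ℝ) (θ₀ : N.Param) {n : ℕ} (X : ℕ → Fin n → Pt N.dim)
    (hV : ∀ k j, V (X k j) = V' (X k j)) (hg : ∀ k j, g (X k j) = g' (X k j)) (k : ℕ) :
    N.iter V g α θ₀ X k = N.iter V' g' α θ₀ X k := by
  induction k with
  | zero => rfl
  | succ k ih => simp only [iter_succ, ih, gradIntegrand, hV, hg]

theorem IsAEBounded.congr (h : IsAEBounded V M₀) (hV : V =ᵐ[unif N.dim] V') : IsAEBounded V' M₀ :=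
  ⟨h.aemeasurable.congr hV, by filter_upwards [h.le, hV] with x h1 h2; rwa [← h2]⟩

section MonteCarlo

variable {K : Set N.Param} {L c α M : ℝ} {θs : N.Param}
  {S : Type*} [MeasurableSpace S] {μ : Measure S} [IsProbabilityMeasure μ] {n : ℕ}
  {X : ℕ → Fin n → S → Pt N.dim} {θ₀ : N.Param}

/-- Genuinely measurable coefficients make the sampled gradient jointly measurable in `(x, θ)`, as
needed to evaluate it at a random iterate. -/
theorem monteCarlo_of_measurable (hVm : Measurable V) (hgm : Measurable g) (hV : IsAEBounded V M₀)
    (hg : IsAEBounded g M₀) (hK : Convex ℝ K) (hKc : IsCompact K)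
    (hL : N.GradLipschitzOn V g K L) (hc : 0 < c) (hcL : c < L)
    (hsc : N.LossStronglyConvexOn V g K c) (hα : 0 < α) (hαL : α * L < 2)
    (hM : ∀ᵐ x ∂(unif N.dim), ∀ θ ∈ K, ‖N.gradIntegrand V g x θ‖ ≤ M) (hθs : θs ∈ K)
    (hn : 1 ≤ n) (hX : ∀ k j, Measurable (X k j)) (hlaw : ∀ k j, μ.map (X k j) = unif N.dim)
    (hind : iIndepFun (fun p : ℕ × Fin n => X p.1 p.2) μ)
    (hiter : ∀ k, ∀ᵐ s ∂μ, N.iter V g α θ₀ (fun i j => X i j s) k ∈ K) :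
    (∀ k, Integrable (fun s => N.loss V g (N.iter V g α θ₀ (fun i j => X i j s) k)) μ) ∧
      limsup (fun k => ((∫ s, (N.loss V g (N.iter V g α θ₀ (fun i j => X i j s) k)
        - N.loss V g θs) ∂μ : ℝ) : EReal)) atTop
        ≤ ((α ^ 2 * L / 2 * ((2 * M) ^ 2 / n) / (1 - (1 - 2 * c * α * (1 - α * L / 2))) : ℝ) :
          EReal) := by
  have hG := measurable_gradIntegrand (N := N) hVm hgm
  have hstep : ∀ k s, N.iter V g α θ₀ (fun i j => X i j s) (k + 1)
      = N.iter V g α θ₀ (fun i j => X i j s) k - α • (1 / (n : ℝ)) • ∑ j,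
        N.gradIntegrand V g (X k j s) (N.iter V g α θ₀ (fun i j => X i j s) k) :=
    fun k s => iter_succ _ _ _ _
  have hϑ : ∀ k, Measurable fun s => N.iter V g α θ₀ (fun i j => X i j s) k := fun k =>
    (measurable_iterate hG (ϑ := fun k s => N.iter V g α θ₀ (fun i j => X i j s) k)
      (fun _ => rfl) hstep k).mono
      (iSup₂_le fun p _ => (hX p.1 p.2).comap_le) le_rfl
  have hq := contraction_mem hα hαL hc hcL
  constructor
  · intro k
    obtain ⟨C, hC⟩ := hKc.exists_bound_of_continuousOn (continuous_loss hV hg).continuousOn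
    refine Integrable.of_bound
      ((continuous_loss hV hg).measurable.comp (hϑ k)).aestronglyMeasurable C ?_
    filter_upwards [hiter k] with s hs using hC _ hs
  · refine limsup_le_of_le_mul_add hq.1 hq.2 fun k => ?_
    simp_rw [hstep k]
    refine integral_step_le (P := unif N.dim) (f := N.loss V g) (f' := gradient (N.loss V g))
      (G := N.gradIntegrand V g) (ϑ := fun s => N.iter V g α θ₀ (fun i j => X i j s) k)
      (ξ := X k) (K := K)
      (fun θ => by rw [gradient_loss hV hg]; exact hasGradientAt_loss hV hg θ)
      (continuous_gradient_loss hV hg).measurable hK hKc hL hc hsc hα (hc.trans hcL) hαL hG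
      (integrable_gradIntegrand hV hg) (fun θ => (gradient_loss hV hg θ).symm) hM hn (hϑ k)
      (hX k) (hlaw k) (fun j => ?_) (fun j l hjl => ?_) (hiter k) ?_ hθs
    · exact indepFun_iterate_sample hG
        (ϑ := fun k s => N.iter V g α θ₀ (fun i j => X i j s) k) (fun _ => rfl) hstep hX hind k j
    · exact indepFun_iterate hG
        (ϑ := fun k s => N.iter V g α θ₀ (fun i j => X i j s) k) (fun _ => rfl) hstep hX hind k hjl
    · filter_upwards [hiter (k + 1)] with s hs
      rwa [← hstep]

/-- Replace `V` and `g` by measurable versions. Every sample has the uniform law and there are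
countably many of them, so almost surely no sample meets the exceptional null sets. The iterates
then agree almost surely for all `k`, and the losses agree everywhere. -/
theorem monteCarlo (hV : IsAEBounded V M₀)
    (hg : IsAEBounded g M₀) (hK : Convex ℝ K) (hKc : IsCompact K)
    (hL : N.GradLipschitzOn V g K L) (hc : 0 < c) (hcL : c < L)
    (hsc : N.LossStronglyConvexOn V g K c) (hα : 0 < α) (hαL : α * L < 2)
    (hM : ∀ᵐ x ∂(unif N.dim), ∀ θ ∈ K, ‖N.gradIntegrand V g x θ‖ ≤ M) (hθs : θs ∈ K)
    (hn : 1 ≤ n) (hX : ∀ k j, Measurable (X k j)) (hlaw : ∀ k j, μ.map (X k j) = unif N.dim)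
    (hind : iIndepFun (fun p : ℕ × Fin n => X p.1 p.2) μ)
    (hiter : ∀ k, ∀ᵐ s ∂μ, N.iter V g α θ₀ (fun i j => X i j s) k ∈ K) :
    (∀ k, Integrable (fun s => N.loss V g (N.iter V g α θ₀ (fun i j => X i j s) k)) μ) ∧
      limsup (fun k => ((∫ s, (N.loss V g (N.iter V g α θ₀ (fun i j => X i j s) k)
        - N.loss V g θs) ∂μ : ℝ) : EReal)) atTop
        ≤ ((α ^ 2 * L / 2 * ((2 * M) ^ 2 / n) / (1 - (1 - 2 * c * α * (1 - α * L / 2))) : ℝ) :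
          EReal) := by
  have hV' := hV.aemeasurable.ae_eq_mk
  have hg' := hg.aemeasurable.ae_eq_mk
  have hVm := hV.aemeasurable.measurable_mk
  have hgm := hg.aemeasurable.measurable_mk
  generalize hV.aemeasurable.mk V = V' at *
  generalize hg.aemeasurable.mk g = g' at *
  have hloss := loss_congr hV' hg'
  have hae : ∀ᵐ s ∂μ, ∀ k, N.iter V g α θ₀ (fun i j => X i j s) k =
      N.iter V' g' α θ₀ (fun i j => X i j s) k := by
    have h1 : ∀ᵐ s ∂μ, ∀ k j, V (X k j s) = V' (X k j s) := by
      simp_rw [ae_all_iff]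
      exact fun k j => ae_of_ae_map (hX k j).aemeasurable (by rw [hlaw k j]; exact hV')
    have h2 : ∀ᵐ s ∂μ, ∀ k j, g (X k j s) = g' (X k j s) := by
      simp_rw [ae_all_iff]
      exact fun k j => ae_of_ae_map (hX k j).aemeasurable (by rw [hlaw k j]; exact hg')
    filter_upwards [h1, h2] with s h1 h2 k using iter_congr _ _ _ h1 h2 k
  have key := monteCarlo_of_measurable (M := M) (θs := θs) (θ₀ := θ₀) (X := X) (μ := μ) hVm hgm
    (hV.congr hV') (hg.congr hg') hK hKc
    (by unfold GradLipschitzOn at *; rwa [← hloss]) hc hcL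
    (by unfold LossStronglyConvexOn at *; rwa [← hloss]) hα hαL
    (by
      filter_upwards [hM, hV', hg'] with x h1 h2 h3 θ hθ
      have := h1 θ hθ
      rwa [gradIntegrand, h2, h3] at this) hθs hn hX hlaw hind
    (fun k => by filter_upwards [hae, hiter k] with s h1 h2; rwa [← h1 k])
  rw [hloss]
  refine ⟨fun k => (key.1 k).congr ?_, le_of_eq_of_le ?_ key.2⟩
  · filter_upwards [hae] with s hs
    rw [hs k]
  · congr 1
    funext k
    congr 1
    refine integral_congr_ae ?_
    filter_upwards [hae] with s hs
    rw [hs k]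

end MonteCarlo

end Arch

/-! ### The Koksma-Hlawka inequality -/

section KoksmaHlawka

set_option linter.unusedSectionVars false

variable {ι : Type*} [Fintype ι] [DecidableEq ι]

/-- The uniform distribution on the unit cube of `ι → ℝ`. -/
def unifPi (ι : Type*) [Fintype ι] : Measure (ι → ℝ) := volume.restrict (Set.Icc 0 1)

instance : IsProbabilityMeasure (unifPi ι) :=
  ⟨by rw [unifPi, Measure.restrict_apply_univ, Real.volume_Icc_pi]; simp⟩

/-- `HasMixedDeriv l M f`: the mixed partial derivatives of `f` along all sublists of `l` are
continuous and bounded by `M` on the unit cube. -/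
def HasMixedDeriv : List ι → ℝ → ((ι → ℝ) → ℝ) → Prop
  | [], M, f => ContinuousOn f (Set.Icc 0 1) ∧ ∀ x ∈ Set.Icc (0 : ι → ℝ) 1, |f x| ≤ M
  | i :: l, M, f => HasMixedDeriv l M f ∧ ∃ f', HasMixedDeriv l M f' ∧
      ∀ x ∈ Set.Icc (0 : ι → ℝ) 1,
        HasDerivWithinAt (fun t => f (Function.update x i t)) (f' x) (Set.Icc 0 1) (x i)

theorem HasMixedDeriv.continuousOn_and_bound {l : List ι} {M : ℝ} {f : (ι → ℝ) → ℝ}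
    (h : HasMixedDeriv l M f) :
    ContinuousOn f (Set.Icc 0 1) ∧ ∀ x ∈ Set.Icc (0 : ι → ℝ) 1, |f x| ≤ M := by
  induction l with
  | nil => exact h
  | cons i l ih => exact ih h.1

theorem HasMixedDeriv.mono {l : List ι} {M M' : ℝ} (hM : M ≤ M') {f : (ι → ℝ) → ℝ}
    (h : HasMixedDeriv l M f) : HasMixedDeriv l M' f := by
  induction l generalizing f with
  | nil => exact ⟨h.1, fun x hx => (h.2 x hx).trans hM⟩
  | cons i l ih =>
    obtain ⟨h1, f', h2, h3⟩ := h
    exact ⟨ih h1, f', ih h2, h3⟩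

theorem uniqueDiffOn_Icc_pi : UniqueDiffOn ℝ (Set.Icc (0 : ι → ℝ) 1) := by
  rw [← Set.pi_univ_Icc]
  exact UniqueDiffOn.univ_pi fun i => uniqueDiffOn_Icc zero_lt_one

theorem update_mem_Icc {x : ι → ℝ} (hx : x ∈ Set.Icc (0 : ι → ℝ) 1) (i : ι) {t : ℝ}
    (ht : t ∈ Set.Icc (0 : ℝ) 1) : Function.update x i t ∈ Set.Icc (0 : ι → ℝ) 1 := by
  constructor
  · intro k
    rcases eq_or_ne k i with rfl | h
    · simpa using ht.1
    · simpa [h] using hx.1 k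
  · intro k
    rcases eq_or_ne k i with rfl | h
    · simpa using ht.2
    · simpa [h] using hx.2 k

/-- Carrying `θ` as an extra variable keeps all derivatives jointly continuous, so compactness of
`T` and of the cube gives one `M` for all `θ ∈ T`. Each coordinate of `l` uses up one order of
differentiability, and derivatives are taken within the closed cube, since nothing is assumed
outside it. -/
theorem exists_hasMixedDeriv {E : Type*} [NormedAddCommGroup E] [NormedSpace ℝ E] {T : Set E}
    (hT : IsCompact T) (l : List ι) {F : E × (ι → ℝ) → ℝ}
    (hF : ContDiffOn ℝ (l.length : ℕ∞) F (Set.univ ×ˢ Set.Icc 0 1)) :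
    ∃ M, ∀ θ ∈ T, HasMixedDeriv l M fun x => F (θ, x) := by
  induction l generalizing F with
  | nil =>
    have hc := hF.continuousOn
    obtain ⟨M, hM⟩ := (hT.prod (isCompact_Icc (a := (0 : ι → ℝ)) (b := 1))).exists_bound_of_continuousOn
      (hc.mono (Set.prod_mono_left (Set.subset_univ T)))
    refine ⟨M, fun θ hθ => ⟨?_, fun x hx => hM (θ, x) ⟨hθ, hx⟩⟩⟩
    exact hc.comp (continuous_const.prodMk continuous_id).continuousOn fun x hx => ⟨trivial, hx⟩
  | cons i l ih =>
    set s : Set (E × (ι → ℝ)) := Set.univ ×ˢ Set.Icc 0 1 with hs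
    have hu : UniqueDiffOn ℝ s := uniqueDiffOn_univ.prod uniqueDiffOn_Icc_pi
    have hF' : ContDiffOn ℝ (l.length : ℕ∞)
        (fun p => fderivWithin ℝ F s p (0, Pi.single i 1)) s :=
      (hF.fderivWithin hu (by simp)).clm_apply contDiffOn_const
    obtain ⟨M₁, h₁⟩ := ih (hF.of_le (by simp))
    obtain ⟨M₂, h₂⟩ := ih hF'
    refine ⟨max M₁ M₂, fun θ hθ => ⟨(h₁ θ hθ).mono (le_max_left _ _), _,
      (h₂ θ hθ).mono (le_max_right _ _), fun x hx => ?_⟩⟩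
    have hd : HasFDerivWithinAt F (fderivWithin ℝ F s (θ, x)) s (θ, Function.update x i (x i)) := by
      rw [Function.update_eq_self]
      exact ((hF.differentiableOn (by simp)) (θ, x) ⟨trivial, hx⟩).hasFDerivWithinAt
    have hc : HasDerivWithinAt (fun t => (θ, Function.update x i t)) ((0 : E), Pi.single i (1 : ℝ))
        (Set.Icc 0 1) (x i) :=
      (hasDerivWithinAt_const _ _ _).prodMk (hasDerivAt_update x i (x i)).hasDerivWithinAt
    have hmaps : Set.MapsTo (fun t => (θ, Function.update x i t)) (Set.Icc 0 1) s :=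
      fun t ht => ⟨trivial, update_mem_Icc hx i ht⟩
    exact hd.comp_hasDerivWithinAt (x i) hc hmaps

/-- The error of the equal weight quadrature rule with nodes `x`. -/
def quadErr {n : ℕ} (x : Fin n → ι → ℝ) (f : (ι → ℝ) → ℝ) : ℝ :=
  (1 / (n : ℝ)) * ∑ j, f (x j) - ∫ y, f y ∂(unifPi ι)

/-- The indicator function of the box `{x | x < b}`. -/
def boxInd (b x : ι → ℝ) : ℝ := if ∀ i, x i < b i then 1 else 0

theorem measurableSet_lt_box {α : Type*} [MeasurableSpace α] {u v : α → ι → ℝ} (hu : Measurable u)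
    (hv : Measurable v) : MeasurableSet {a | ∀ i, u a i < v a i} := by
  have : {a | ∀ i, u a i < v a i} = ⋂ i, {a | u a i < v a i} := by ext; simp
  rw [this]
  exact MeasurableSet.iInter fun i =>
    measurableSet_lt ((measurable_pi_apply i).comp hu) ((measurable_pi_apply i).comp hv)

theorem measurable_boxInd {α : Type*} [MeasurableSpace α] {u v : α → ι → ℝ} (hu : Measurable u)
    (hv : Measurable v) : Measurable fun a => boxInd (v a) (u a) :=
  Measurable.ite (measurableSet_lt_box hu hv) measurable_const measurable_const

theorem abs_boxInd_le (b x : ι → ℝ) : |boxInd b x| ≤ 1 := by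
  unfold boxInd; split_ifs <;> simp

/-- By Fubini the quadrature error of an average over `t` is the average of the errors. The interval
has length one, so the bound `C` is preserved. -/
theorem abs_quadErr_integral_le {n : ℕ} {x : Fin n → ι → ℝ} {H : ℝ → (ι → ℝ) → ℝ} {C : ℝ}
    (hH : Integrable (Function.uncurry H) ((volume.restrict (Set.Ioc (0 : ℝ) 1)).prod (unifPi ι)))
    (hHx : ∀ j, Integrable (fun t => H t (x j)) (volume.restrict (Set.Ioc (0 : ℝ) 1)))
    (hC : ∀ t ∈ Set.Ioc (0 : ℝ) 1, |quadErr x (H t)| ≤ C) :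
    |quadErr x fun y => ∫ t in Set.Ioc (0 : ℝ) 1, H t y| ≤ C := by
  have e : (quadErr x fun y => ∫ t in Set.Ioc (0 : ℝ) 1, H t y)
      = ∫ t in Set.Ioc (0 : ℝ) 1, quadErr x (H t) := by
    unfold quadErr
    have h1 : Integrable (fun t => ∫ y, H t y ∂(unifPi ι)) (volume.restrict (Set.Ioc (0 : ℝ) 1)) :=
      hH.integral_prod_left
    rw [integral_sub ((integrable_finsetSum _ fun j _ => hHx j).const_mul _) h1,
      integral_const_mul, integral_finsetSum _ fun j _ => hHx j, integral_integral_swap hH]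
  rw [e]
  have := norm_setIntegral_le_of_norm_le_const (μ := volume) (s := Set.Ioc (0 : ℝ) 1)
    (f := fun t => quadErr x (H t)) (C := C) (by simp) hC
  simpa using this

/-- The point with the coordinates of `x` in `l` and those of `z` elsewhere. -/
def merge (l : List ι) (z x : ι → ℝ) : ι → ℝ := fun i => if i ∈ l then x i else z i

theorem merge_mem_Icc {l : List ι} {z x : ι → ℝ} (hz : z ∈ Set.Icc (0 : ι → ℝ) 1)
    (hx : x ∈ Set.Icc (0 : ι → ℝ) 1) : merge l z x ∈ Set.Icc (0 : ι → ℝ) 1 := by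
  constructor <;> intro i <;> unfold merge <;> split_ifs
  exacts [hx.1 i, hz.1 i, hx.2 i, hz.2 i]

theorem continuous_merge {α : Type*} [TopologicalSpace α] {l : List ι} {z x : α → ι → ℝ}
    (hz : Continuous z) (hx : Continuous x) : Continuous fun a => merge l (z a) (x a) := by
  refine continuous_pi fun i => ?_
  unfold merge
  split_ifs
  exacts [(continuous_apply i).comp hx, (continuous_apply i).comp hz]

theorem merge_cons {l : List ι} {i : ι} (hi : i ∉ l) (z x : ι → ℝ) :
    merge (i :: l) z x = merge l (Function.update z i (x i)) x := by
  ext k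
  unfold merge
  rcases eq_or_ne k i with rfl | h
  · simp [hi]
  · simp [h]

theorem update_merge {l : List ι} {i : ι} (hi : i ∉ l) (z x : ι → ℝ) (s t : ℝ) :
    Function.update (merge l (Function.update z i s) x) i t
      = merge l (Function.update z i t) x := by
  ext k
  unfold merge
  rcases eq_or_ne k i with rfl | h
  · simp [hi]
  · simp [h]

/-- Since `x i < b i`, the `i`-th constraint of `b` holds already, and moving that side to `t` just
adds the condition `x i < t`. -/
theorem boxInd_update {b x : ι → ℝ} {i : ι} (hb : x i < b i) (t : ℝ) :
    boxInd (Function.update b i t) x = if x i < t then boxInd b x else 0 := by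
  unfold boxInd
  rw [← ite_and]
  congr 1
  refine propext ⟨fun h => ⟨by simpa using h i, fun k => ?_⟩, fun h k => ?_⟩
  · rcases eq_or_ne k i with rfl | hk
    · exact hb
    · simpa [hk] using h k
  · rcases eq_or_ne k i with rfl | hk
    · simpa using h.1
    · simpa [hk] using h.2 k

/-- Fundamental theorem of calculus in coordinate `i`, from `x i` to `1`. As `b i > 1` leaves that
coordinate free, the range `t > x i` can be written as a box side, and the integrand is again a box
indicator times a function that is frozen in coordinate `i`. -/
theorem boxInd_mul_eq {l : List ι} {i : ι} (hi : i ∉ l) {f f' : (ι → ℝ) → ℝ}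
    (hf' : ContinuousOn f' (Set.Icc 0 1))
    (hd : ∀ x ∈ Set.Icc (0 : ι → ℝ) 1,
        HasDerivWithinAt (fun t => f (Function.update x i t)) (f' x) (Set.Icc 0 1) (x i))
    {z b x : ι → ℝ} (hz : z ∈ Set.Icc (0 : ι → ℝ) 1) (hb : 1 < b i)
    (hx : x ∈ Set.Icc (0 : ι → ℝ) 1) :
    boxInd b x * f (merge (i :: l) z x) = boxInd b x * f (merge l (Function.update z i 1) x)
      - ∫ t in Set.Ioc (0 : ℝ) 1, boxInd (Function.update b i t) x
          * f' (merge l (Function.update z i t) x) := by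
  have hx0 : 0 ≤ x i := hx.1 i
  have hx1 : x i ≤ 1 := hx.2 i
  set ψ : ℝ → ℝ := fun t => f' (merge l (Function.update z i t) x) with hψ
  have hmem : ∀ t ∈ Set.Icc (0 : ℝ) 1, merge l (Function.update z i t) x ∈ Set.Icc (0 : ι → ℝ) 1 :=
    fun t ht => merge_mem_Icc (update_mem_Icc hz i ht) hx
  have hder : ∀ t ∈ Set.Icc (0 : ℝ) 1,
      HasDerivWithinAt (fun t => f (merge l (Function.update z i t) x)) (ψ t) (Set.Icc 0 1) t :=
    fun t ht => by
      have := hd _ (hmem t ht)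
      simp only [update_merge hi] at this
      simpa [merge, hi] using this
  have hψc : ContinuousOn ψ (Set.Icc 0 1) := by
    refine hf'.comp (Continuous.continuousOn ?_) hmem
    exact continuous_merge (continuous_const.update i continuous_id) continuous_const
  have hsub : Set.Icc (x i) 1 ⊆ Set.Icc 0 1 := Set.Icc_subset_Icc_left hx0
  have ftc : ∫ t in (x i)..1, ψ t
      = f (merge l (Function.update z i 1) x) - f (merge l (Function.update z i (x i)) x) := by
    refine intervalIntegral.integral_eq_sub_of_hasDeriv_right
      (f := fun t => f (merge l (Function.update z i t) x)) ?_ ?_ ?_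
    · rw [Set.uIcc_of_le hx1]
      exact fun t ht => ((hder t (hsub ht)).continuousWithinAt).mono hsub
    · intro t ht
      rw [min_eq_left hx1, max_eq_right hx1] at ht
      exact ((hder t (hsub ⟨ht.1.le, ht.2.le⟩)).hasDerivAt
        (Icc_mem_nhds (hx0.trans_lt ht.1) ht.2)).hasDerivWithinAt
    · refine ContinuousOn.intervalIntegrable ?_
      rw [Set.uIcc_of_le hx1]
      exact hψc.mono hsub
  have e : ∫ t in Set.Ioc (0 : ℝ) 1, boxInd (Function.update b i t) x * ψ t
      = boxInd b x * ∫ t in (x i)..1, ψ t := by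
    rw [intervalIntegral.integral_of_le hx1, ← integral_const_mul]
    have h1 : ∀ t, boxInd (Function.update b i t) x * ψ t
        = (Set.Ioi (x i)).indicator (fun t => boxInd b x * ψ t) t := fun t => by
      rw [boxInd_update (hx1.trans_lt hb), Set.indicator_apply]
      simp [ite_mul]
    simp_rw [h1]
    rw [setIntegral_indicator measurableSet_Ioi]
    congr 2
    ext t
    simp only [Set.mem_inter_iff, Set.mem_Ioc, Set.mem_Ioi]
    exact ⟨fun h => ⟨h.2, h.1.2⟩, fun h => ⟨⟨hx0.trans_lt h.1, h.2⟩, h.1⟩⟩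
  rw [e, ftc, merge_cons hi]
  ring

theorem quadErr_congr {n : ℕ} {x : Fin n → ι → ℝ} (hx : ∀ j, x j ∈ Set.Icc (0 : ι → ℝ) 1)
    {f g : (ι → ℝ) → ℝ} (h : ∀ y ∈ Set.Icc (0 : ι → ℝ) 1, f y = g y) :
    quadErr x f = quadErr x g := by
  unfold quadErr unifPi
  rw [setIntegral_congr_fun measurableSet_Icc h]
  simp_rw [h _ (hx _)]

theorem quadErr_sub {n : ℕ} {x : Fin n → ι → ℝ} {f g : (ι → ℝ) → ℝ} (hf : Integrable f (unifPi ι))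
    (hg : Integrable g (unifPi ι)) :
    quadErr x (fun y => f y - g y) = quadErr x f - quadErr x g := by
  unfold quadErr
  rw [integral_sub hf hg, Finset.sum_sub_distrib]
  ring

theorem integrable_boxInd_mul {α : Type*} [TopologicalSpace α] [MeasurableSpace α] [BorelSpace α]
    [SecondCountableTopology α]
    {ν : Measure α} {s : Set α} (hs : MeasurableSet s) (hν : ν s ≠ ⊤) {f : (ι → ℝ) → ℝ} {M : ℝ}
    (hf : ContinuousOn f (Set.Icc 0 1)) (hM : ∀ x ∈ Set.Icc (0 : ι → ℝ) 1, |f x| ≤ M)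
    {u v : α → ι → ℝ} (hu : Measurable u) (hv : Measurable v) {w : α → ι → ℝ} (hw : Continuous w)
    (hws : Set.MapsTo w s (Set.Icc 0 1)) :
    Integrable (fun a => boxInd (v a) (u a) * f (w a)) (ν.restrict s) := by
  have : IsFiniteMeasure (ν.restrict s) := ⟨by simpa using hν.lt_top⟩
  refine Integrable.of_bound ((measurable_boxInd hu hv).aestronglyMeasurable.mul
    ((hf.comp hw.continuousOn hws).aestronglyMeasurable hs)) M ?_
  filter_upwards [ae_restrict_mem hs] with a ha
  rw [norm_mul, Real.norm_eq_abs, Real.norm_eq_abs]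
  calc _ ≤ 1 * M := mul_le_mul (abs_boxInd_le _ _) (hM _ (hws ha)) (abs_nonneg _) zero_le_one
    _ = M := one_mul M

theorem volume_Icc_pi_ne_top : volume (Set.Icc (0 : ι → ℝ) 1) ≠ ⊤ :=
  isCompact_Icc.measure_lt_top.ne

/-- The Koksma-Hlawka inequality on boxes, for the coordinates in `l`. -/
theorem abs_quadErr_boxInd_mul_le {n : ℕ} {x : Fin n → ι → ℝ}
    (hx : ∀ j, x j ∈ Set.Icc (0 : ι → ℝ) 1) {D : ℝ}
    (hD : ∀ b : ι → ℝ, 0 ≤ b → |quadErr x (boxInd b)| ≤ D) {l : List ι} (hl : l.Nodup)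
    {M : ℝ} {f : (ι → ℝ) → ℝ} (hf : HasMixedDeriv l M f) {z b : ι → ℝ}
    (hz : z ∈ Set.Icc (0 : ι → ℝ) 1) (hb : 0 ≤ b) (hbl : ∀ i ∈ l, 1 < b i) :
    |quadErr x fun y => boxInd b y * f (merge l z y)| ≤ 2 ^ l.length * M * D := by
  induction l generalizing f z b with
  | nil =>
    -- With all coordinates frozen the function is the constant `f z`, and only the box error
    -- remains.
    have h1 : (quadErr x fun y => boxInd b y * f (merge [] z y)) = f z * quadErr x (boxInd b) := by
      have : ∀ y, merge [] z y = z := fun y => by ext i; simp [merge]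
      simp only [quadErr, this, integral_mul_const, ← Finset.sum_mul]
      ring
    rw [h1, abs_mul]
    simpa using mul_le_mul (hf.2 z hz) (hD b hb) (abs_nonneg _) ((abs_nonneg _).trans (hf.2 z hz))
  | cons i l ih =>
    obtain ⟨hil, hl⟩ := List.nodup_cons.1 hl
    obtain ⟨h1, f', h2, h3⟩ := hf
    obtain ⟨hfc, hfM⟩ := h1.continuousOn_and_bound
    obtain ⟨hfc', hfM'⟩ := h2.continuousOn_and_bound
    rw [quadErr_congr hx fun y hy =>
      boxInd_mul_eq hil hfc' h3 hz (hbl i List.mem_cons_self) hy]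
    have hz1 := update_mem_Icc hz i (t := 1) ⟨zero_le_one, le_rfl⟩
    have hH : Integrable (Function.uncurry fun (t : ℝ) y => boxInd (Function.update b i t) y
        * f' (merge l (Function.update z i t) y))
        ((volume.restrict (Set.Ioc (0 : ℝ) 1)).prod (unifPi ι)) := by
      rw [unifPi, Measure.prod_restrict]
      refine integrable_boxInd_mul (measurableSet_Ioc.prod measurableSet_Icc) ?_ hfc' hfM'
        measurable_snd ((continuous_const.update i continuous_fst).measurable)
        (continuous_merge (continuous_const.update i continuous_fst) continuous_snd) ?_
      · rw [Measure.prod_prod]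
        exact ENNReal.mul_ne_top (by simp) volume_Icc_pi_ne_top
      · exact fun p hp => merge_mem_Icc (update_mem_Icc hz i (Set.Ioc_subset_Icc_self hp.1)) hp.2
    rw [quadErr_sub]
    -- One bound for the boundary term at `1` and one, uniform in `t`, for the integral term: each
    -- coordinate doubles the constant.
    · have e1 := ih hl h1 hz1 hb fun k hk => hbl k (List.mem_cons_of_mem _ hk)
      have e2 := abs_quadErr_integral_le (x := x) hH (fun j => ?_) (fun t ht => ih hl h2
        (update_mem_Icc hz i (Set.Ioc_subset_Icc_self ht)) (b := Function.update b i t) ?_ ?_)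
      · calc _ ≤ _ := abs_sub _ _
          _ ≤ _ := add_le_add e1 e2
          _ = _ := by rw [List.length_cons, pow_succ]; ring
      · refine integrable_boxInd_mul measurableSet_Ioc (by simp) hfc' hfM' measurable_const
          ((continuous_const.update i continuous_id).measurable)
          (continuous_merge (continuous_const.update i continuous_id) continuous_const) ?_
        exact fun t ht => merge_mem_Icc (update_mem_Icc hz i (Set.Ioc_subset_Icc_self ht)) (hx j)
      · intro k
        rcases eq_or_ne k i with rfl | h
        · simpa using ht.1.le
        · simpa [h] using hb k
      · intro k hk
        rw [Function.update_of_ne (ne_of_mem_of_not_mem hk hil)]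
        exact hbl k (List.mem_cons_of_mem _ hk)
    · exact integrable_boxInd_mul measurableSet_Icc volume_Icc_pi_ne_top hfc hfM measurable_id
        measurable_const (continuous_merge continuous_const continuous_id)
        fun y hy => merge_mem_Icc hz1 hy
    · exact hH.integral_prod_right

/-- The Koksma-Hlawka inequality. -/
theorem abs_quadErr_le {n : ℕ} {x : Fin n → ι → ℝ} (hx : ∀ j, x j ∈ Set.Icc (0 : ι → ℝ) 1) {D : ℝ}
    (hD : ∀ b : ι → ℝ, 0 ≤ b → |quadErr x (boxInd b)| ≤ D) {M : ℝ} {f : (ι → ℝ) → ℝ}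
    (hf : HasMixedDeriv Finset.univ.toList M f) :
    |quadErr x f| ≤ 2 ^ Fintype.card ι * M * D := by
  -- Sides equal to `2` exceed `1`, so the indicator is `1` on the whole closed cube. The base point
  -- `0` is irrelevant because every coordinate is in the list.
  have h := abs_quadErr_boxInd_mul_le hx hD (Finset.nodup_toList _) hf (z := 0) (b := fun _ => 2)
    ⟨le_rfl, zero_le_one⟩ (fun _ => zero_le_two) (fun _ _ => one_lt_two)
  rw [Finset.length_toList, Finset.card_univ] at h
  rwa [quadErr_congr hx fun y hy => ?_]
  have h1 : boxInd (fun _ => 2) y = 1 :=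
    if_pos fun i => (hy.2 i).trans_lt (one_lt_two : (1 : ℝ) < 2)
  have h2 : merge Finset.univ.toList 0 y = y := by ext i; simp [merge]
  rw [h1, h2, one_mul]

end KoksmaHlawka

/-! ### Star discrepancy of nets in base 2 -/

section Nets

/-- The indicator function of `[x, y)`. -/
def icoInd (x y p : ℝ) : ℝ := if x ≤ p ∧ p < y then 1 else 0

theorem icoInd_nonneg (x y p : ℝ) : 0 ≤ icoInd x y p := by unfold icoInd; split_ifs <;> simp

theorem icoInd_add {x y z : ℝ} (hxy : x ≤ y) (hyz : y ≤ z) (p : ℝ) :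
    icoInd x y p + icoInd y z p = icoInd x z p := by
  unfold icoInd
  rcases lt_or_ge p y with h | h
  · simp [h, h.trans_le hyz, not_le.2 h]
  · simp [h, hxy.trans h, not_lt.2 h]

theorem icoInd_le_of_subset {x y x' y' : ℝ} (hx : x' ≤ x) (hy : y ≤ y') (p : ℝ) :
    icoInd x y p ≤ icoInd x' y' p := by
  unfold icoInd
  split_ifs with h1 h2 h2
  · exact le_rfl
  · exact absurd ⟨hx.trans h1.1, h1.2.trans_le hy⟩ h2
  · exact zero_le_one
  · exact le_rfl

variable {d n : ℕ}

/-- The number of points in the box `[l, u)`. -/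
def boxCount (y : Fin n → Fin d → ℝ) (l u : Fin d → ℝ) : ℝ := ∑ j, ∏ k, icoInd (l k) (u k) (y j k)

/-- The number of points in the box `[l, u)`, minus the expected number. -/
def boxErr (y : Fin n → Fin d → ℝ) (l u : Fin d → ℝ) : ℝ := boxCount y l u - n * ∏ k, (u k - l k)

open Classical in
theorem boxCount_eq_card (y : Fin n → Fin d → ℝ) (l u : Fin d → ℝ) :
    boxCount y l u = ((Finset.univ.filter fun j => ∀ k, l k ≤ y j k ∧ y j k < u k).card : ℝ) := by
  simp [boxCount, icoInd, Finset.prod_ite_zero, Finset.sum_boole]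

theorem boxCount_nonneg (y : Fin n → Fin d → ℝ) (l u : Fin d → ℝ) : 0 ≤ boxCount y l u :=
  Finset.sum_nonneg fun _ _ => Finset.prod_nonneg fun _ _ => icoInd_nonneg _ _ _

theorem boxCount_mono (y : Fin n → Fin d → ℝ) {l u l' u' : Fin d → ℝ} (hl : l' ≤ l) (hu : u ≤ u') :
    boxCount y l u ≤ boxCount y l' u' :=
  Finset.sum_le_sum fun _ _ => Finset.prod_le_prod (fun _ _ => icoInd_nonneg _ _ _)
    fun k _ => icoInd_le_of_subset (hl k) (hu k) _

/-- Splitting one side of a box is additive for any product of additive interval functions; this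
serves both the counting and the volume part of `boxErr`. -/
theorem prod_update_add {h : Fin d → ℝ → ℝ → ℝ} {l u : Fin d → ℝ} {i : Fin d} {x y z : ℝ}
    (hadd : h i x y + h i y z = h i x z) :
    ∏ k, h k (Function.update l i x k) (Function.update u i y k)
      + ∏ k, h k (Function.update l i y k) (Function.update u i z k)
      = ∏ k, h k (Function.update l i x k) (Function.update u i z k) := by
  have e : ∀ s t, ∏ k, h k (Function.update l i s k) (Function.update u i t k)
      = h i s t * ∏ k ∈ Finset.univ.erase i, h k (l k) (u k) := fun s t => by
    rw [← Finset.mul_prod_erase _ _ (Finset.mem_univ i)]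
    congr 1
    · simp
    · exact Finset.prod_congr rfl fun k hk => by simp [Finset.ne_of_mem_erase hk]
  rw [e, e, e, ← add_mul, hadd]

theorem boxErr_update_add (p : Fin n → Fin d → ℝ) (l u : Fin d → ℝ) (i : Fin d) {x y z : ℝ}
    (hxy : x ≤ y) (hyz : y ≤ z) :
    boxErr p (Function.update l i x) (Function.update u i y)
      + boxErr p (Function.update l i y) (Function.update u i z)
      = boxErr p (Function.update l i x) (Function.update u i z) := by
  have h1 : boxCount p (Function.update l i x) (Function.update u i y)
      + boxCount p (Function.update l i y) (Function.update u i z)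
      = boxCount p (Function.update l i x) (Function.update u i z) := by
    unfold boxCount
    rw [← Finset.sum_add_distrib]
    exact Finset.sum_congr rfl fun j _ =>
      prod_update_add (h := fun k a b => icoInd a b (p j k)) (icoInd_add hxy hyz _)
  have h2 := prod_update_add (h := fun (_ : Fin d) a b => b - a) (l := l) (u := u) (i := i)
    (x := x) (y := y) (z := z) (by ring)
  unfold boxErr
  linear_combination h1 - (n : ℝ) * h2

theorem boxErr_update_self (p : Fin n → Fin d → ℝ) (l u : Fin d → ℝ) (i : Fin d) (x : ℝ) :
    boxErr p (Function.update l i x) (Function.update u i x) = 0 := by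
  have := boxErr_update_add p l u i (le_refl x) (le_refl x)
  linarith

/-- Lower end points of a dyadic box. -/
def dyadicLo (e a : Fin d → ℕ) (k : Fin d) : ℝ := (a k : ℝ) / 2 ^ e k

/-- Upper end points of a dyadic box. -/
def dyadicHi (e a : Fin d → ℕ) (k : Fin d) : ℝ := ((a k : ℝ) + 1) / 2 ^ e k

theorem prod_dyadic (e a : Fin d → ℕ) :
    ∏ k, (dyadicHi e a k - dyadicLo e a k) = 1 / 2 ^ ∑ k, e k := by
  rw [← Finset.prod_pow_eq_pow_sum, one_div, ← Finset.prod_inv_distrib]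
  exact Finset.prod_congr rfl fun k _ => by unfold dyadicHi dyadicLo; ring

theorem dyadicLo_update (e a : Fin d → ℕ) (i : Fin d) (r s : ℕ) :
    dyadicLo (Function.update e i r) (Function.update a i s)
      = Function.update (dyadicLo e a) i ((s : ℝ) / 2 ^ r) := by
  ext k
  rcases eq_or_ne k i with rfl | h
  · simp [dyadicLo]
  · simp [dyadicLo, h]

theorem dyadicHi_update (e a : Fin d → ℕ) (i : Fin d) (r s : ℕ) :
    dyadicHi (Function.update e i r) (Function.update a i s)
      = Function.update (dyadicHi e a) i (((s : ℝ) + 1) / 2 ^ r) := by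
  ext k
  rcases eq_or_ne k i with rfl | h
  · simp [dyadicHi]
  · simp [dyadicHi, h]

theorem sum_update_add (e : Fin d → ℕ) (i : Fin d) (r : ℕ) :
    ∑ k, Function.update e i r k + e i = ∑ k, e k + r := by
  rw [Finset.sum_update_of_mem (Finset.mem_univ i), ← Finset.add_sum_erase _ _ (Finset.mem_univ i),
    Finset.sdiff_singleton_eq_erase]
  ring

theorem update_lt_two_pow {e a : Fin d → ℕ} (ha : ∀ k, a k < 2 ^ e k) (i : Fin d) {r s : ℕ}
    (h : s < 2 ^ r) (k : Fin d) : Function.update a i s k < 2 ^ Function.update e i r k := by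
  rcases eq_or_ne k i with rfl | hk
  · simpa using h
  · simpa [hk] using ha k

variable {t m : ℕ} {X : Fin (2 ^ m) → Pt d}

theorem IsNet.boxCount_eq (h : IsNet t m X) {e a : Fin d → ℕ} (he : ∑ k, e k + t = m)
    (ha : ∀ k, a k < 2 ^ e k) :
    boxCount (fun j => (X j).ofLp) (dyadicLo e a) (dyadicHi e a) = 2 ^ t := by
  rw [boxCount_eq_card]
  exact (congrArg (Nat.cast : ℕ → ℝ) (h.2 e a he ha)).trans (by simp)

/-- A box of volume at least `2^(t-m)` is halved repeatedly until the net property applies; both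
terms of the error are additive. Having a side to halve requires `d > 0`. -/
theorem IsNet.boxErr_eq_zero (h : IsNet t m X) (hd : 0 < d) {e a : Fin d → ℕ}
    (he : ∑ k, e k + t ≤ m) (ha : ∀ k, a k < 2 ^ e k) :
    boxErr (fun j => (X j).ofLp) (dyadicLo e a) (dyadicHi e a) = 0 := by
  obtain ⟨q, hq⟩ := Nat.exists_eq_add_of_le he
  induction q generalizing e a with
  | zero =>
    rw [add_zero] at hq
    unfold boxErr
    rw [h.boxCount_eq hq.symm ha, prod_dyadic, hq]
    push_cast
    field_simp
    ring
  | succ q ih =>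
    have i : Fin d := ⟨0, hd⟩
    have hs := sum_update_add e i (e i + 1)
    have hlt := ha i
    have hp : 2 ^ (e i + 1) = 2 * 2 ^ e i := by ring
    have e1 := ih (e := Function.update e i (e i + 1)) (a := Function.update a i (2 * a i))
      (by omega) (update_lt_two_pow ha i (by omega)) (by omega)
    have e2 := ih (e := Function.update e i (e i + 1)) (a := Function.update a i (2 * a i + 1))
      (by omega) (update_lt_two_pow ha i (by omega)) (by omega)
    have e3 := boxErr_update_add (fun j => (X j).ofLp) (dyadicLo e a) (dyadicHi e a) i
      (x := (a i : ℝ) / 2 ^ e i) (y := (2 * (a i : ℝ) + 1) / 2 ^ (e i + 1))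
      (z := ((a i : ℝ) + 1) / 2 ^ e i)
      (by rw [pow_succ, div_le_div_iff₀ (by positivity) (by positivity)]
          nlinarith [show (0 : ℝ) < 2 ^ e i by positivity])
      (by rw [pow_succ, div_le_div_iff₀ (by positivity) (by positivity)]
          nlinarith [show (0 : ℝ) < 2 ^ e i by positivity])
    rw [dyadicLo_update, dyadicHi_update] at e1 e2
    push_cast at e1 e2
    have r1 : 2 * (a i : ℝ) / 2 ^ (e i + 1) = (a i : ℝ) / 2 ^ e i := by
      rw [pow_succ]; field_simp
    have r2 : (2 * (a i : ℝ) + 1 + 1) / 2 ^ (e i + 1) = ((a i : ℝ) + 1) / 2 ^ e i := by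
      rw [pow_succ]; field_simp; ring
    rw [r1] at e1
    rw [r2] at e2
    rw [e1, e2, add_zero] at e3
    have l1 : Function.update (dyadicLo e a) i ((a i : ℝ) / 2 ^ e i) = dyadicLo e a :=
      Function.update_eq_self i (dyadicLo e a)
    have l2 : Function.update (dyadicHi e a) i (((a i : ℝ) + 1) / 2 ^ e i) = dyadicHi e a :=
      Function.update_eq_self i (dyadicHi e a)
    rw [l1, l2] at e3
    exact e3.symm

/-- A box of volume below `2^(t-m)` lies in its dyadic parents, one of which has exactly that volume
and hence `2^t` points. -/
theorem IsNet.boxCount_le (h : IsNet t m X) {e a : Fin d → ℕ}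
    (he : m ≤ ∑ k, e k + t) (ha : ∀ k, a k < 2 ^ e k) :
    boxCount (fun j => (X j).ofLp) (dyadicLo e a) (dyadicHi e a) ≤ 2 ^ t := by
  obtain ⟨q, hq⟩ := Nat.exists_eq_add_of_le he
  induction q generalizing e a with
  | zero => exact (h.boxCount_eq (by omega) ha).le
  | succ q ih =>
    have htm := h.1
    obtain ⟨i, -, hi⟩ : ∃ i ∈ Finset.univ, 0 < e i := by
      by_contra! hcon
      have : ∑ k, e k = 0 := Finset.sum_eq_zero fun i hi => Nat.le_zero.1 (hcon i hi)
      omega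
    obtain ⟨r, hr⟩ : ∃ r, e i = r + 1 := ⟨e i - 1, by omega⟩
    have hs := sum_update_add e i r
    have hlt := ha i
    rw [hr, pow_succ] at hlt
    refine le_trans (boxCount_mono _ ?_ ?_) (ih (e := Function.update e i r)
      (a := Function.update a i (a i / 2)) (by omega)
      (update_lt_two_pow ha i (by omega)) (by omega))
    · rw [dyadicLo_update, update_le_iff]
      refine ⟨?_, fun _ _ => le_rfl⟩
      have h2 : ((2 * (a i / 2) : ℕ) : ℝ) ≤ a i := by exact_mod_cast Nat.mul_div_le _ _
      push_cast at h2
      rw [dyadicLo, hr, pow_succ, div_le_div_iff₀ (by positivity) (by positivity)]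
      nlinarith [show (0 : ℝ) < 2 ^ r by positivity]
    · rw [dyadicHi_update, le_update_iff]
      refine ⟨?_, fun _ _ => le_rfl⟩
      have h2 : (a i : ℝ) ≤ ((2 * (a i / 2) + 1 : ℕ) : ℝ) := by
        exact_mod_cast (by omega : a i ≤ 2 * (a i / 2) + 1)
      push_cast at h2
      rw [dyadicHi, hr, pow_succ, div_le_div_iff₀ (by positivity) (by positivity)]
      nlinarith [show (0 : ℝ) < 2 ^ r by positivity]

theorem IsNet.abs_boxErr_dyadic_le (h : IsNet t m X) (hd : 0 < d) {e a : Fin d → ℕ}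
    (ha : ∀ k, a k < 2 ^ e k) :
    |boxErr (fun j => (X j).ofLp) (dyadicLo e a) (dyadicHi e a)| ≤ 2 ^ t := by
  rcases le_total (∑ k, e k + t) m with he | he
  · rw [h.boxErr_eq_zero hd he ha]; simp
  · have h1 := h.boxCount_le he ha
    have h2 := boxCount_nonneg (fun j => (X j).ofLp) (dyadicLo e a) (dyadicHi e a)
    have h3 : (2 : ℝ) ^ m * (1 / 2 ^ ∑ k, e k) ≤ 2 ^ t := by
      rw [mul_one_div, div_le_iff₀ (by positivity), ← pow_add, add_comm t]
      exact pow_le_pow_right₀ one_le_two he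
    have h4 : (0 : ℝ) ≤ (2 : ℝ) ^ m * (1 / 2 ^ ∑ k, e k) := by positivity
    unfold boxErr
    rw [prod_dyadic, abs_le]
    push_cast
    constructor <;> linarith

/-- `β` rounded down to a multiple of `2 ^ (-k)`. -/
def dyadicFloor (β : ℝ) (k : ℕ) : ℝ := (⌊β * 2 ^ k⌋₊ : ℝ) / 2 ^ k

theorem dyadicFloor_le {β : ℝ} (hβ : 0 ≤ β) (k : ℕ) : dyadicFloor β k ≤ β := by
  rw [dyadicFloor, div_le_iff₀ (by positivity)]
  exact Nat.floor_le (by positivity)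

theorem lt_dyadicFloor_add (β : ℝ) (k : ℕ) : β < ((⌊β * 2 ^ k⌋₊ : ℝ) + 1) / 2 ^ k := by
  rw [lt_div_iff₀ (by positivity)]
  exact Nat.lt_floor_add_one _

theorem dyadicFloor_nonneg (β : ℝ) (k : ℕ) : 0 ≤ dyadicFloor β k := by
  unfold dyadicFloor; positivity

theorem dyadicFloor_succ {β : ℝ} (hβ : 0 ≤ β) (k : ℕ) :
    dyadicFloor β (k + 1) = dyadicFloor β k ∨
      ⌊β * 2 ^ (k + 1)⌋₊ = 2 * ⌊β * 2 ^ k⌋₊ + 1 := by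
  have h0 : 0 ≤ β * 2 ^ k := by positivity
  have h1 := Nat.floor_le h0
  have h2 := Nat.lt_floor_add_one (β * 2 ^ k)
  have e : β * 2 ^ (k + 1) = 2 * (β * 2 ^ k) := by ring
  have l1 : 2 * ⌊β * 2 ^ k⌋₊ ≤ ⌊β * 2 ^ (k + 1)⌋₊ := by
    rw [Nat.le_floor_iff (by positivity)]; push_cast; linarith
  have l2 : ⌊β * 2 ^ (k + 1)⌋₊ < 2 * ⌊β * 2 ^ k⌋₊ + 2 := by
    rw [Nat.floor_lt (by positivity)]; push_cast; linarith
  rcases (by omega : ⌊β * 2 ^ (k + 1)⌋₊ = 2 * ⌊β * 2 ^ k⌋₊ ∨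
    ⌊β * 2 ^ (k + 1)⌋₊ = 2 * ⌊β * 2 ^ k⌋₊ + 1) with h | h
  · left
    unfold dyadicFloor
    rw [h, pow_succ]
    push_cast
    field_simp
  · exact Or.inr h

/-- The half-open interval `[x, y)` is dyadic and contained in `[0, 1)`. -/
def IsDyadic (x y : ℝ) : Prop :=
  ∃ e a : ℕ, a < 2 ^ e ∧ x = (a : ℝ) / 2 ^ e ∧ y = ((a : ℝ) + 1) / 2 ^ e

theorem IsDyadic.bounds {x y : ℝ} (h : IsDyadic x y) : 0 ≤ x ∧ x ≤ y ∧ y ≤ 1 := by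
  obtain ⟨e, a, ha, rfl, rfl⟩ := h
  refine ⟨by positivity, by gcongr; linarith, ?_⟩
  rw [div_le_one (by positivity)]
  exact_mod_cast ha

/-- The box lies in a slab of width `2^(-m)` in direction `i`, so it has at most `2^t` points, and
its expected number of points is at most `1`. -/
theorem IsNet.abs_boxErr_le_of_thin (h : IsNet t m X) {l u : Fin d → ℝ}
    (hlu : ∀ k, 0 ≤ l k ∧ l k ≤ u k ∧ u k ≤ 1) {i : Fin d} {s : ℕ} (hs : s < 2 ^ m)
    (hl : (s : ℝ) / 2 ^ m ≤ l i) (hu : u i ≤ ((s : ℝ) + 1) / 2 ^ m) :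
    |boxErr (fun j => (X j).ofLp) l u| ≤ 2 ^ t := by
  have h2 := boxCount_nonneg (fun j => (X j).ofLp) l u
  set e : Fin d → ℕ := Function.update 0 i m with he
  set a : Fin d → ℕ := Function.update 0 i s with ha
  have hsum : ∑ k, e k = m := by
    have := sum_update_add (0 : Fin d → ℕ) i m
    simpa using this
  have h1 : boxCount (fun j => (X j).ofLp) l u ≤ 2 ^ t := by
    refine le_trans (boxCount_mono _ ?_ ?_) (h.boxCount_le (e := e) (a := a) (by omega)
      (update_lt_two_pow (e := 0) (a := 0) (by simp) i hs))
    · rw [he, ha, dyadicLo_update, update_le_iff]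
      exact ⟨hl, fun k _ => by simpa [dyadicLo] using (hlu k).1⟩
    · rw [he, ha, dyadicHi_update, le_update_iff]
      exact ⟨hu, fun k _ => by simpa [dyadicHi] using (hlu k).2.2⟩
  have h3 : ∏ k, (u k - l k) ≤ 1 / 2 ^ m := by
    rw [← Finset.mul_prod_erase _ _ (Finset.mem_univ i)]
    have e1 : u i - l i ≤ 1 / 2 ^ m := by
      rw [add_div] at hu; linarith
    have e2 : ∏ k ∈ Finset.univ.erase i, (u k - l k) ≤ 1 :=
      Finset.prod_le_one (fun k _ => by linarith [(hlu k).2.1])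
        fun k _ => by linarith [(hlu k).1, (hlu k).2.2]
    have e3 : 0 ≤ ∏ k ∈ Finset.univ.erase i, (u k - l k) :=
      Finset.prod_nonneg fun k _ => by linarith [(hlu k).2.1]
    calc _ ≤ 1 / 2 ^ m * 1 := mul_le_mul e1 e2 e3 (by positivity)
      _ = _ := mul_one _
  have h4 : 0 ≤ ∏ k, (u k - l k) := Finset.prod_nonneg fun k _ => by linarith [(hlu k).2.1]
  have h5 : (2 : ℝ) ^ m * ∏ k, (u k - l k) ≤ 1 := by
    calc _ ≤ (2 : ℝ) ^ m * (1 / 2 ^ m) := by gcongr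
      _ = 1 := by field_simp
  have h6 : (1 : ℝ) ≤ 2 ^ t := one_le_pow₀ one_le_two
  have h7 : (0 : ℝ) ≤ 2 ^ m * ∏ k, (u k - l k) := by positivity
  unfold boxErr
  rw [abs_le]
  push_cast
  constructor <;> linarith

/-- Induction on the number of non-dyadic sides `[0, β)`. Such a side is cut at the binary
truncations of `β`: the integer part, `m` increments that are empty or dyadic, and a remainder
shorter than `2^(-m)`. These are `m + 2` pieces per side. Dyadic pieces fall to the induction
hypothesis and the remainder is thin. -/
theorem IsNet.abs_boxErr_le (h : IsNet t m X) (hd : 0 < d)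
    (s : Finset (Fin d)) {l u : Fin d → ℝ} (hs : ∀ k ∈ s, l k = 0 ∧ 0 ≤ u k ∧ u k ≤ 1)
    (hsc : ∀ k ∉ s, IsDyadic (l k) (u k)) :
    |boxErr (fun j => (X j).ofLp) l u| ≤ (m + 2) ^ s.card * 2 ^ t := by
  induction s using Finset.induction_on generalizing l u with
  | empty =>
    choose e a ha hl hu using fun k => hsc k (Finset.notMem_empty k)
    have := h.abs_boxErr_dyadic_le hd ha
    rw [show dyadicLo e a = l from funext fun k => (hl k).symm,
      show dyadicHi e a = u from funext fun k => (hu k).symm] at this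
    simpa using this
  | insert i s hi ih =>
    obtain ⟨hl0, hβ0, hβ1⟩ := hs i (Finset.mem_insert_self i s)
    set β := u i with hβ
    set p := fun j => (X j).ofLp with hp
    set A := dyadicFloor β with hA
    set C : ℝ := (m + 2) ^ s.card * 2 ^ t with hC
    have hC1 : (2 : ℝ) ^ t ≤ C :=
      le_mul_of_one_le_left (by positivity) (one_le_pow₀ (by linarith [Nat.cast_nonneg (α := ℝ) m]))
    have hlu : ∀ k, 0 ≤ l k ∧ l k ≤ u k ∧ u k ≤ 1 := fun k => by
      by_cases hk : k ∈ insert i s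
      · obtain ⟨h1, h2, h3⟩ := hs k hk
        exact ⟨h1.ge, h1 ▸ h2, h3⟩
      · exact (hsc k hk).bounds
    have hdy : ∀ x y, IsDyadic x y →
        |boxErr p (Function.update l i x) (Function.update u i y)| ≤ C := fun x y hxy => by
      refine ih (fun k hk => ?_) fun k hk => ?_
      · have hki : k ≠ i := ne_of_mem_of_not_mem hk hi
        simpa [hki] using hs k (Finset.mem_insert_of_mem hk)
      · rcases eq_or_ne k i with rfl | hki
        · simpa using hxy
        · simpa [hki] using hsc k (by simp [hki, hk])
    set F : ℝ → ℝ := fun x => boxErr p (Function.update l i 0) (Function.update u i x) with hF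
    have hFsub : ∀ x y, 0 ≤ x → x ≤ y →
        F y - F x = boxErr p (Function.update l i x) (Function.update u i y) := fun x y hx hxy => by
      have := boxErr_update_add p l u i hx hxy
      simp only [hF]; linarith
    have hF0 : F 0 = 0 := boxErr_update_self p l u i 0
    have hA0 : |F (A 0)| ≤ C := by
      have : A 0 = 0 ∨ A 0 = 1 := by
        have h1 : ⌊β⌋₊ ≤ 1 := Nat.floor_le_of_le (by simpa using hβ1)
        simp only [hA, dyadicFloor, pow_zero, mul_one, div_one]
        rcases (by omega : ⌊β⌋₊ = 0 ∨ ⌊β⌋₊ = 1) with h | h <;> simp [h]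
      rcases this with h0 | h0
      · rw [h0, hF0, abs_zero]; positivity
      · rw [h0]
        exact hdy 0 1 ⟨0, 0, by simp, by simp, by simp⟩
    have hAk : ∀ k, |F (A (k + 1)) - F (A k)| ≤ C := fun k => by
      rcases dyadicFloor_succ hβ0 k with h0 | h0
      · rw [hA, h0, sub_self, abs_zero]; positivity
      · have e1 : A k = ((2 * ⌊β * 2 ^ k⌋₊ : ℕ) : ℝ) / 2 ^ (k + 1) := by
          simp only [hA, dyadicFloor]; rw [pow_succ]; push_cast; field_simp
        have e2 : A (k + 1) = (((2 * ⌊β * 2 ^ k⌋₊ : ℕ) : ℝ) + 1) / 2 ^ (k + 1) := by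
          simp only [hA, dyadicFloor]; rw [h0]; push_cast; ring
        have hle : A k ≤ A (k + 1) := by rw [e1, e2]; gcongr; linarith
        rw [hFsub _ _ (dyadicFloor_nonneg _ _) hle]
        refine hdy _ _ ⟨k + 1, 2 * ⌊β * 2 ^ k⌋₊, ?_, e1, e2⟩
        have h2 : ⌊β * 2 ^ (k + 1)⌋₊ ≤ 2 ^ (k + 1) := Nat.floor_le_of_le (by
          push_cast
          exact mul_le_of_le_one_left (by positivity) hβ1)
        omega
    have hlast : |F β - F (A m)| ≤ 2 ^ t := by
      have hle : A m ≤ β := dyadicFloor_le hβ0 m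
      -- The slab index must be below `2 ^ m`. Otherwise `β = 1`, and the remainder is empty.
      by_cases hb : ⌊β * 2 ^ m⌋₊ < 2 ^ m
      · rw [hFsub _ _ (dyadicFloor_nonneg _ _) hle]
        refine h.abs_boxErr_le_of_thin (fun k => ?_) hb (i := i) ?_ ?_
        · rcases eq_or_ne k i with rfl | hki
          · simpa using ⟨dyadicFloor_nonneg _ _, hle, hβ1⟩
          · simpa [hki] using hlu k
        · simp [dyadicFloor]
        · simpa using (lt_dyadicFloor_add β m).le
      · have : A m = β := by
          refine le_antisymm hle (hβ1.trans ?_)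
          simp only [hA, dyadicFloor]
          rw [one_le_div (by positivity)]
          exact_mod_cast not_lt.1 hb
        rw [this, sub_self, abs_zero]; positivity
    have htel : F β = F (A 0) + ∑ k ∈ Finset.range m, (F (A (k + 1)) - F (A k))
        + (F β - F (A m)) := by
      rw [Finset.sum_range_sub fun k => F (A k)]; ring
    have hsum : |∑ k ∈ Finset.range m, (F (A (k + 1)) - F (A k))| ≤ m * C := by
      refine (Finset.abs_sum_le_sum_abs _ _).trans ?_
      have := Finset.sum_le_card_nsmul (Finset.range m) (fun k => |F (A (k + 1)) - F (A k)|) C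
        fun k _ => hAk k
      simpa using this
    have hgoal : boxErr p l u = F β := by
      simp only [hF, hβ, Function.update_eq_self]
      rw [← hl0, Function.update_eq_self]
    rw [hgoal, htel, Finset.card_insert_of_notMem hi, pow_succ]
    calc _ ≤ |F (A 0)| + |∑ k ∈ Finset.range m, (F (A (k + 1)) - F (A k))| + |F β - F (A m)| :=
          abs_add_three _ _ _
      _ ≤ C + m * C + C := by gcongr; exact hlast.trans hC1
      _ = _ := by rw [hC]; ring

theorem starDiscrepancy_le {n : ℕ} {X : Fin n → Pt d} {D : ℝ}
    (h : ∀ a : Fin d → ℝ, (∀ i, 0 ≤ a i ∧ a i ≤ 1) →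
      |boxCount (fun j => (X j).ofLp) 0 a / n - ∏ i, a i| ≤ D) (hX : ∀ j i, 0 ≤ X j i) :
    starDiscrepancy X ≤ D := by
  classical
  refine csSup_le (Set.Nonempty.image _ ⟨0, fun i => by simp⟩) ?_
  rintro _ ⟨a, ha, rfl⟩
  have := h a.ofLp ha
  rw [boxCount_eq_card] at this
  simp only [Pi.zero_apply, hX, true_and] at this
  convert this using 5

theorem IsNet.starDiscrepancy_le (h : IsNet t m X) (hd : 0 < d)
    (hX : ∀ j k, 0 ≤ X j k) :
    starDiscrepancy X ≤ (m + 2) ^ d * 2 ^ t / 2 ^ m := by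
  refine DeepRitz.starDiscrepancy_le (fun a ha => ?_) hX
  have h1 := h.abs_boxErr_le hd Finset.univ (l := 0) (u := a) (fun k _ => ⟨rfl, ha k⟩)
    fun k hk => absurd (Finset.mem_univ k) hk
  rw [Finset.card_univ, Fintype.card_fin] at h1
  have e : boxCount (fun j => (X j).ofLp) 0 a / ((2 ^ m : ℕ) : ℝ) - ∏ i, a i
      = boxErr (fun j => (X j).ofLp) 0 a / 2 ^ m := by
    unfold boxErr
    simp only [Pi.zero_apply, sub_zero]
    push_cast
    field_simp
  rw [e, abs_div, abs_of_pos (show (0 : ℝ) < 2 ^ m by positivity)]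
  gcongr

theorem boxCount_le (y : Fin n → Fin d → ℝ) (l u : Fin d → ℝ) : boxCount y l u ≤ n := by
  classical
  rw [boxCount_eq_card]
  exact_mod_cast (Finset.card_filter_le _ _).trans (by simp)

theorem starDiscrepancy_le_one {n : ℕ} {X : Fin n → Pt d} (hX : ∀ j i, 0 ≤ X j i) :
    starDiscrepancy X ≤ 1 := by
  refine DeepRitz.starDiscrepancy_le (fun a ha => ?_) hX
  have h1 : boxCount (fun j => (X j).ofLp) 0 a / n ≤ 1 :=
    div_le_one_of_le₀ (boxCount_le _ _ _) (Nat.cast_nonneg n)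
  have h2 : 0 ≤ boxCount (fun j => (X j).ofLp) 0 a / n :=
    div_nonneg (boxCount_nonneg _ _ _) (Nat.cast_nonneg n)
  have h3 : ∏ i, a i ≤ 1 := Finset.prod_le_one (fun i _ => (ha i).1) fun i _ => (ha i).2
  have h4 : 0 ≤ ∏ i, a i := Finset.prod_nonneg fun i _ => (ha i).1
  rw [abs_le]
  constructor <;> linarith

theorem IsTSequence.starDiscrepancy_block_le {P : ℕ → Pt d} (hP : IsTSequence t P) (hd : 0 < d)
    {τ : ℕ} (hτ : 1 ≤ τ) (k : ℕ) :
    starDiscrepancy (block P (2 ^ τ) k) ≤ (2 ^ t * (3 / Real.log 2) ^ d)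
      * ((((2 ^ τ : ℕ) : ℝ))⁻¹ * Real.log ((2 ^ τ : ℕ) : ℝ) ^ d) := by
  have hlog : 0 < Real.log 2 := Real.log_pos one_lt_two
  have hτ' : (1 : ℝ) ≤ τ := by exact_mod_cast hτ
  have e : (2 ^ t * (3 / Real.log 2) ^ d) * ((((2 ^ τ : ℕ) : ℝ))⁻¹
      * Real.log ((2 ^ τ : ℕ) : ℝ) ^ d) = (3 * (τ : ℝ)) ^ d * 2 ^ t / 2 ^ τ := by
    push_cast
    rw [Real.log_pow, mul_pow, mul_pow, div_pow]
    field_simp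
  rw [e]
  have hX : ∀ j i, 0 ≤ block P (2 ^ τ) k j i := fun j i => (hP.1 _ i).1
  -- For `τ ≤ t` no net property is assumed, but the trivial bound `1 ≤ 2^t / 2^τ` suffices. For `τ
  -- > t` one has `τ + 2 ≤ 3τ`, and `τ = log n / log 2` accounts for the constant `3 / log 2`.
  rcases le_or_gt τ t with h | h
  · refine (starDiscrepancy_le_one hX).trans ?_
    rw [one_le_div (by positivity)]
    calc (2 : ℝ) ^ τ ≤ 1 * 2 ^ t := by rw [one_mul]; exact pow_le_pow_right₀ one_le_two h
      _ ≤ _ := by gcongr; exact one_le_pow₀ (by linarith)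
  · refine ((hP.2 τ h k).starDiscrepancy_le hd hX).trans ?_
    gcongr
    linarith

end Nets

/-! ### From star discrepancy to quadrature errors of box indicators -/

section Discrepancy

variable {d n : ℕ}

open Classical in
theorem abs_card_div_sub_prod_le_starDiscrepancy {X : Fin n → Pt d}
    {a : Fin d → ℝ} (ha : ∀ i, 0 ≤ a i ∧ a i ≤ 1) :
    |((Finset.univ.filter fun j => ∀ i, X j i < a i).card : ℝ) / n - ∏ i, a i|
      ≤ starDiscrepancy X := by
  refine le_csSup ⟨1, ?_⟩ ⟨WithLp.toLp 2 a, ha, rfl⟩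
  rintro _ ⟨b, hb, rfl⟩
  have h1 : ((Finset.univ.filter fun j => ∀ i, X j i < b i).card : ℝ) / n ≤ 1 :=
    div_le_one_of_le₀ (by exact_mod_cast (Finset.card_filter_le _ _).trans (by simp))
      (Nat.cast_nonneg n)
  have h2 : 0 ≤ ((Finset.univ.filter fun j => ∀ i, X j i < b i).card : ℝ) / n := by positivity
  have h3 : ∏ i, b i ≤ 1 := Finset.prod_le_one (fun i _ => (hb i).1) fun i _ => (hb i).2
  have h4 : 0 ≤ ∏ i, b i := Finset.prod_nonneg fun i _ => (hb i).1
  dsimp only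
  rw [abs_le]
  constructor <;> linarith

theorem starDiscrepancy_nonneg (X : Fin n → Pt d) : 0 ≤ starDiscrepancy X :=
  (abs_nonneg _).trans (abs_card_div_sub_prod_le_starDiscrepancy (a := 0) (by simp))

theorem volume_Icc_inter_Iio (b : ℝ) :
    volume (Set.Icc (0 : ℝ) 1 ∩ Set.Iio b) = ENNReal.ofReal (min b 1) := by
  apply le_antisymm
  · calc _ ≤ volume (Set.Icc 0 (min b 1)) :=
        measure_mono fun x hx => ⟨hx.1.1, le_min (le_of_lt hx.2) hx.1.2⟩
      _ = _ := by rw [Real.volume_Icc, sub_zero]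
  · calc _ = volume (Set.Ioo 0 (min b 1)) := by rw [Real.volume_Ioo, sub_zero]
      _ ≤ _ := by
        refine measure_mono fun x hx => ?_
        exact ⟨⟨hx.1.le, (hx.2.trans_le (min_le_right _ _)).le⟩, hx.2.trans_le (min_le_left _ _)⟩

theorem integral_boxInd {b : Fin d → ℝ} (hb : 0 ≤ b) :
    ∫ y, boxInd b y ∂(unifPi (Fin d)) = ∏ i, min (b i) 1 := by
  have hm : MeasurableSet {y : Fin d → ℝ | ∀ i, y i < b i} :=
    measurableSet_lt_box measurable_id measurable_const
  have e : boxInd b = {y : Fin d → ℝ | ∀ i, y i < b i}.indicator 1 := by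
    ext y; simp [boxInd, Set.indicator_apply]
  have e2 : {y : Fin d → ℝ | ∀ i, y i < b i} ∩ Set.Icc 0 1
      = Set.univ.pi fun i => Set.Icc (0 : ℝ) 1 ∩ Set.Iio (b i) := by
    ext y
    simp only [Set.mem_inter_iff, Set.mem_ofPred_eq, Set.mem_Icc, Pi.le_def, Set.mem_univ_pi,
      Set.mem_Iio, Pi.zero_apply, Pi.one_apply]
    exact ⟨fun h i => ⟨⟨h.2.1 i, h.2.2 i⟩, h.1 i⟩,
      fun h => ⟨fun i => (h i).2, fun i => (h i).1.1, fun i => (h i).1.2⟩⟩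
  rw [e, integral_indicator_one hm, unifPi, measureReal_restrict_apply hm, e2, measureReal_def,
    volume_pi_pi, ENNReal.toReal_prod]
  refine Finset.prod_congr rfl fun i _ => ?_
  rw [volume_Icc_inter_Iio (b i), ENNReal.toReal_ofReal (le_min (hb i) zero_le_one)]

/-- Sides above `1` are cut down to `1`, which loses only points having a coordinate equal to `1`.
The anchored box with all sides `1` shows that these are at most a fraction `D*` of the points,
hence the factor `2`. -/
theorem abs_quadErr_boxInd_le {X : Fin n → Pt d} (hX : ∀ j, X j ∈ cube d) {b : Fin d → ℝ}
    (hb : 0 ≤ b) :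
    |quadErr (fun j => (X j).ofLp) (boxInd b)| ≤ 2 * starDiscrepancy X := by
  classical
  set a : Fin d → ℝ := fun i => min (b i) 1 with ha
  set s := Finset.univ.filter fun j => ∀ i, X j i < b i with hs
  set s₁ := Finset.univ.filter fun j => ∀ i, X j i < a i with hs₁
  set s₂ := Finset.univ.filter fun j => ∀ i, X j i < (1 : Fin d → ℝ) i with hs₂
  have h1 := abs_card_div_sub_prod_le_starDiscrepancy (X := X) (a := a)
    fun i => ⟨le_min (hb i) zero_le_one, min_le_right _ _⟩
  have h2 := abs_card_div_sub_prod_le_starDiscrepancy (X := X) (a := 1) (by simp)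
  have h3 : s₁ ⊆ s := Finset.monotone_filter_right _ fun j _ hj i =>
    (hj i).trans_le (min_le_left _ _)
  have h4 : s ⊆ s₁ ∪ (Finset.univ \ s₂) := fun j hj => by
    by_cases h : j ∈ s₂
    · refine Finset.mem_union_left _ ?_
      simp only [hs, hs₁, hs₂, Finset.mem_filter, Finset.mem_univ, true_and] at hj h ⊢
      exact fun i => lt_min (hj i) (h i)
    · simp [h]
  have h5 : (s₁.card : ℝ) / n ≤ s.card / n := by gcongr
  have h6 : (s.card : ℝ) / n ≤ s₁.card / n + (1 - s₂.card / n) := by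
    rcases Nat.eq_zero_or_pos n with rfl | hn
    · simp
    have h7 := (Finset.card_le_card h4).trans (Finset.card_union_le _ _)
    have h8 := Finset.card_sdiff_add_card_eq_card (Finset.subset_univ s₂)
    rw [Finset.card_univ, Fintype.card_fin] at h8
    have h7' : (s.card : ℝ) ≤ s₁.card + (Finset.univ \ s₂).card := by exact_mod_cast h7
    have h8' : ((Finset.univ \ s₂).card : ℝ) + s₂.card = n := by exact_mod_cast h8
    have hn' : (0 : ℝ) < n := by exact_mod_cast hn
    rw [one_sub_div hn'.ne', ← add_div]
    gcongr
    linarith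
  have e : quadErr (fun j => (X j).ofLp) (boxInd b) = (s.card : ℝ) / n - ∏ i, a i := by
    unfold quadErr
    rw [integral_boxInd hb]
    rw [one_div, ← div_eq_inv_mul]
    congr 2
    rw [hs, Finset.card_filter]
    push_cast
    exact Finset.sum_congr rfl fun j _ => by unfold boxInd; congr
  rw [e]
  simp only [Pi.one_apply, Finset.prod_const_one] at h2
  rw [abs_le] at h1 h2 ⊢
  have h9 := starDiscrepancy_nonneg X
  change _ ≤ (s₁.card : ℝ) / n - _ ∧ (s₁.card : ℝ) / n - _ ≤ _ at h1
  change _ ≤ (s₂.card : ℝ) / n - _ ∧ (s₂.card : ℝ) / n - _ ≤ _ at h2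
  constructor <;> linarith

end Discrepancy

/-! ### The quasi-Monte Carlo bound for the Ritz loss -/

theorem norm_le_sum_abs {ι : Type*} [Fintype ι] (x : EuclideanSpace ℝ ι) : ‖x‖ ≤ ∑ i, |x i| := by
  rw [EuclideanSpace.norm_eq]
  refine Real.sqrt_le_iff.2 ⟨Finset.sum_nonneg fun _ _ => abs_nonneg _, ?_⟩
  exact Finset.sum_sq_le_sq_sum_of_nonneg fun _ _ => abs_nonneg _

theorem integral_unif_eq {d : ℕ} (f : Pt d → ℝ) :
    ∫ x, f x ∂(unif d) = ∫ y, f (WithLp.toLp 2 y) ∂(unifPi (Fin d)) := by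
  rw [unif, unifPi, cube_eq_preimage, ← (EuclideanSpace.volume_preserving_symm_measurableEquiv_toLp
    (Fin d)).setIntegral_preimage_emb (MeasurableEquiv.measurableEmbedding _)]
  rfl

namespace Arch

variable {N : Arch} {V g : Pt N.dim → ℝ} {M₀ : ℝ}

theorem contDiffOn_gradIntegrand (hV : ContDiffOn ℝ (N.dim : ℕ∞) V (cube N.dim))
    (hg : ContDiffOn ℝ (N.dim : ℕ∞) g (cube N.dim)) (i : N.Idx) :
    ContDiffOn ℝ (N.dim : ℕ∞)
      (fun p : N.Param × (Fin N.dim → ℝ) => N.gradIntegrand V g (WithLp.toLp 2 p.2) p.1 i)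
      (Set.univ ×ˢ Set.Icc 0 1) := by
  have hle : ((N.dim : ℕ∞) : WithTop ℕ∞) ≤ ((⊤ : ℕ∞) : WithTop ℕ∞) := by
    exact_mod_cast le_top
  have hlp : ContDiff ℝ (⊤ : ℕ∞) (fun p : N.Param × (Fin N.dim → ℝ) => (WithLp.toLp 2 p.2 : Pt N.dim)) :=
    (PiLp.contDiff_toLp).comp contDiff_snd
  have hmaps : Set.MapsTo (fun p : N.Param × (Fin N.dim → ℝ) => (WithLp.toLp 2 p.2 : Pt N.dim))
      (Set.univ ×ˢ Set.Icc 0 1) (cube N.dim) := fun p hp i => ⟨hp.2.1 i, hp.2.2 i⟩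
  have hc : ∀ {A : Pt N.dim × N.Param → N.Param}, ContDiff ℝ (⊤ : ℕ∞) A →
      ContDiffOn ℝ (N.dim : ℕ∞) (fun p : N.Param × (Fin N.dim → ℝ) => A (WithLp.toLp 2 p.2, p.1))
        (Set.univ ×ˢ Set.Icc 0 1) := fun hA =>
    ((hA.comp (hlp.prodMk contDiff_fst)).of_le hle).contDiffOn
  have hc' : ∀ {f : Pt N.dim → ℝ}, ContDiffOn ℝ (N.dim : ℕ∞) f (cube N.dim) →
      ContDiffOn ℝ (N.dim : ℕ∞) (fun p : N.Param × (Fin N.dim → ℝ) => f (WithLp.toLp 2 p.2))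
        (Set.univ ×ˢ Set.Icc 0 1) := fun hf => hf.comp (hlp.of_le hle).contDiffOn hmaps
  exact contDiffOn_euclidean.1 (((hc (contDiff_gradSnd N.contDiff_energy)).sub
    ((hc' hg).smul (hc N.contDiff_gradSnd_v))).add
    ((hc' hV).smul (hc (contDiff_gradSnd N.contDiff_mass)))) i

/-- The quasi-Monte Carlo error of the gradient. -/
theorem exists_norm_gradient_sub_le (hVb : IsAEBounded V M₀) (hgb : IsAEBounded g M₀)
    (hV : ContDiffOn ℝ (N.dim : ℕ∞) V (cube N.dim))
    (hg : ContDiffOn ℝ (N.dim : ℕ∞) g (cube N.dim)) {K : Set N.Param} (hK : IsCompact K) :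
    ∃ C, 0 ≤ C ∧ ∀ (n : ℕ) (X : Fin n → Pt N.dim), (∀ j, X j ∈ cube N.dim) → ∀ θ ∈ K,
      ‖gradient (N.empLoss V g X) θ - gradient (N.loss V g) θ‖ ≤ C * starDiscrepancy X := by
  have hex : ∀ i : N.Idx, ∃ M, ∀ θ ∈ K, HasMixedDeriv (Finset.univ : Finset (Fin N.dim)).toList M
      fun y => N.gradIntegrand V g (WithLp.toLp 2 y) θ i := fun i => by
    refine exists_hasMixedDeriv hK _ (F := fun p : N.Param × (Fin N.dim → ℝ) =>
      N.gradIntegrand V g (WithLp.toLp 2 p.2) p.1 i) ?_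
    rw [Finset.length_toList, Finset.card_univ, Fintype.card_fin]
    exact contDiffOn_gradIntegrand hV hg i
  choose M hM using hex
  -- Per component of the gradient: `2^d |M i|` from Koksma-Hlawka and `2` from the passage to
  -- arbitrary boxes.
  refine ⟨∑ i, 2 ^ N.dim * |M i| * 2, by positivity, fun n X hX θ hθ => ?_⟩
  refine (norm_le_sum_abs _).trans ?_
  rw [Finset.sum_mul]
  refine Finset.sum_le_sum fun i _ => ?_
  have h := abs_quadErr_le (x := fun j => (X j).ofLp) (fun j => ⟨fun i => (hX j i).1,
    fun i => (hX j i).2⟩) (fun b hb => abs_quadErr_boxInd_le hX hb)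
    ((hM i θ hθ).mono (le_abs_self _))
  rw [Fintype.card_fin] at h
  have e : (gradient (N.empLoss V g X) θ - gradient (N.loss V g) θ) i = quadErr
      (fun j => (X j).ofLp) fun y => N.gradIntegrand V g (WithLp.toLp 2 y) θ i := by
    rw [gradient_empLoss, gradient_loss hVb hgb, quadErr,
      ← integral_unif_eq fun x => N.gradIntegrand V g x θ i]
    have h1 := (EuclideanSpace.proj (𝕜 := ℝ) i).integral_comp_comm
      (integrable_gradIntegrand hVb hgb θ)
    simp only [PiLp.proj_apply] at h1
    rw [h1]
    simp
  rw [e]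
  calc _ ≤ _ := h
    _ = _ := by ring

/-- Quasi-Monte Carlo mini-batches. -/
theorem exists_quasiMonteCarlo (hVb : IsAEBounded V M₀) (hgb : IsAEBounded g M₀)
    (hV : ContDiffOn ℝ (N.dim : ℕ∞) V (cube N.dim))
    (hg : ContDiffOn ℝ (N.dim : ℕ∞) g (cube N.dim)) {K : Set N.Param} (hK : Convex ℝ K)
    (hKc : IsCompact K) {L c α : ℝ}
    (hL : N.GradLipschitzOn V g K L) (hc : 0 < c) (hcL : c < L)
    (hsc : N.LossStronglyConvexOn V g K c) (hα : 0 < α) (hαL : α * L < 2) {θs : N.Param}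
    (hθs : θs ∈ K) :
    ∃ C : ℝ, ∀ (n : ℕ) (X : ℕ → Fin n → Pt N.dim) (θ₀ : N.Param) (D : ℝ),
      (∀ k j, X k j ∈ cube N.dim) → (∀ k, starDiscrepancy (X k) ≤ D) →
      (∀ k, N.iter V g α θ₀ X k ∈ K) →
      limsup (fun k => ((N.loss V g (N.iter V g α θ₀ X k) - N.loss V g θs : ℝ) : EReal)) atTop
        ≤ ((C * D : ℝ) : EReal) := by
  obtain ⟨C₀, hC₀, hC⟩ := exists_norm_gradient_sub_le hVb hgb hV hg hKc
  obtain ⟨M, hM⟩ := hKc.exists_bound_of_continuousOn (continuous_gradient_loss hVb hgb).continuousOn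
  have hM0 : 0 ≤ M := (norm_nonneg _).trans (hM θs hθs)
  have hq := contraction_mem hα hαL hc hcL
  have hL0 := hc.trans hcL
  refine ⟨(|α ^ 2 * L - α| * (M * C₀) + α ^ 2 * L / 2 * C₀ ^ 2)
    / (1 - (1 - 2 * c * α * (1 - α * L / 2))), fun n X θ₀ D hX hD hiter => ?_⟩
  rw [div_mul_eq_mul_div]
  refine limsup_le_of_le_mul_add hq.1 hq.2 fun k => ?_
  have hstep := step_bound (f := N.loss V g) (f' := gradient (N.loss V g))
    (fun θ => by rw [gradient_loss hVb hgb]; exact hasGradientAt_loss hVb hgb θ) hK hL hc hsc hα hαL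
    (g := gradient (N.empLoss V g (X k)) (N.iter V g α θ₀ X k)) (hiter k) hθs (hiter (k + 1))
  have hr := hC n (X k) (hX k) _ (hiter k)
  set r := gradient (N.empLoss V g (X k)) (N.iter V g α θ₀ X k)
    - gradient (N.loss V g) (N.iter V g α θ₀ X k) with hrdef
  set δ := starDiscrepancy (X k)
  have hδ0 : 0 ≤ δ := starDiscrepancy_nonneg _
  -- This lets the quadratic error term be absorbed into the linear one, by `δ² ≤ δ`.
  have hδ1 : δ ≤ 1 := starDiscrepancy_le_one fun j i => (hX k j i).1
  have h1 : (α ^ 2 * L - α) * inner ℝ (gradient (N.loss V g) (N.iter V g α θ₀ X k)) r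
      ≤ |α ^ 2 * L - α| * (M * C₀) * δ := by
    calc _ ≤ |α ^ 2 * L - α| * |inner ℝ (gradient (N.loss V g) (N.iter V g α θ₀ X k)) r| := by
          rw [← abs_mul]; exact le_abs_self _
      _ ≤ |α ^ 2 * L - α| * (M * (C₀ * δ)) := by
          gcongr
          exact (abs_real_inner_le_norm _ _).trans
            (mul_le_mul (hM _ (hiter k)) hr (norm_nonneg _) hM0)
      _ = _ := by ring
  have h2 : α ^ 2 * L / 2 * ‖r‖ ^ 2 ≤ α ^ 2 * L / 2 * C₀ ^ 2 * δ := by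
    have h3 : ‖r‖ ^ 2 ≤ (C₀ * δ) ^ 2 := pow_le_pow_left₀ (norm_nonneg _) hr 2
    have h4 : (C₀ * δ) ^ 2 ≤ C₀ ^ 2 * δ := by
      rw [mul_pow]
      gcongr
      rw [sq]
      exact mul_le_of_le_one_left hδ0 hδ1
    rw [mul_assoc (α ^ 2 * L / 2)]
    gcongr
    exact h3.trans h4
  have h5 : (|α ^ 2 * L - α| * (M * C₀) + α ^ 2 * L / 2 * C₀ ^ 2) * δ
      ≤ (|α ^ 2 * L - α| * (M * C₀) + α ^ 2 * L / 2 * C₀ ^ 2) * D := by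
    gcongr
    exact hD k
  rw [iter]
  linarith

end Arch

end DeepRitz

end

/-! ### Assembly of the theorem -/

theorem theorem3p8 (N : DeepRitz.Arch) (B : ℝ) (hB : 0 < B)
    (V g : DeepRitz.Pt N.dim → ℝ) (Vmin Vmax : ℝ) (hVmin : 0 < Vmin)
    (hVmeas : AEMeasurable V (DeepRitz.unif N.dim))
    (hV : ∀ᵐ x ∂(DeepRitz.unif N.dim), Vmin ≤ V x ∧ V x ≤ Vmax)
    (hgmeas : AEMeasurable g (DeepRitz.unif N.dim))
    (hg : ∃ M : ℝ, ∀ᵐ x ∂(DeepRitz.unif N.dim), |g x| ≤ M) :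
    -- the gradient of the loss has a Lipschitz constant on all of Θ
    (∃ L₇ : ℝ, 0 < L₇ ∧ N.GradLipschitzOn V g (N.Theta B) L₇) ∧
    -- the case `K = Θ` is the one of main interest
    ∀ K : Set N.Param, K ⊆ N.Theta B → K.Nonempty → IsClosed K → Convex ℝ K →
    ∀ L₇ c α : ℝ, N.GradLipschitzOn V g K L₇ → 0 < c → c < L₇ →
      N.LossStronglyConvexOn V g K c → 0 < α → α < 2 / L₇ →
    ∃ θs ∈ K, IsMinOn (N.loss V g) K θs ∧
      -- (i) Monte Carlo: i.i.d. uniform sample points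
      (∃ C : ℝ, ∀ (n : ℕ), 1 ≤ n →
        ∀ (S : Type*) [MeasurableSpace S] (μ : Measure S) [IsProbabilityMeasure μ]
          (X : ℕ → Fin n → S → DeepRitz.Pt N.dim) (θ₀ : N.Param),
          (∀ k j, Measurable (X k j)) →
          (∀ k j, Measure.map (X k j) μ = DeepRitz.unif N.dim) →
          iIndepFun (fun p : ℕ × Fin n => X p.1 p.2) μ →
          (∀ k, ∀ᵐ s ∂μ, N.iter V g α θ₀ (fun i j => X i j s) k ∈ K) →
          (∀ k, Integrable (fun s => N.loss V g (N.iter V g α θ₀ (fun i j => X i j s) k)) μ) ∧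
          limsup (fun k => ((∫ s, (N.loss V g (N.iter V g α θ₀ (fun i j => X i j s) k)
            - N.loss V g θs) ∂μ : ℝ) : EReal)) atTop ≤ ((C * (n : ℝ)⁻¹ : ℝ) : EReal)) ∧
      -- (ii) quasi-Monte Carlo
      (ContDiffOn ℝ (N.dim : ℕ∞) V (DeepRitz.cube N.dim) →
        ContDiffOn ℝ (N.dim : ℕ∞) g (DeepRitz.cube N.dim) →
        -- mini-batches of low discrepancy points, uniformly in the step `k`
        (∀ R : ℝ, ∃ C : ℝ, ∀ (n : ℕ), 2 ≤ n →
          ∀ (X : ℕ → Fin n → DeepRitz.Pt N.dim) (θ₀ : N.Param),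
            (∀ k j, X k j ∈ DeepRitz.cube N.dim) →
            (∀ k, DeepRitz.starDiscrepancy (X k) ≤ R * ((n : ℝ)⁻¹ * Real.log n ^ N.dim)) →
            (∀ k, N.iter V g α θ₀ X k ∈ K) →
            limsup (fun k => ((N.loss V g (N.iter V g α θ₀ X k)
              - N.loss V g θs : ℝ) : EReal)) atTop
              ≤ ((C * ((n : ℝ)⁻¹ * Real.log n ^ N.dim) : ℝ) : EReal)) ∧
        -- consecutive blocks of length `n = 2 ^ τ` of a `(t, d)`-sequence in base 2
        (∀ t : ℕ, ∃ C : ℝ, ∀ (P : ℕ → DeepRitz.Pt N.dim), DeepRitz.IsTSequence t P →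
          ∀ (τ : ℕ), 1 ≤ τ → ∀ (n : ℕ), n = 2 ^ τ → ∀ (θ₀ : N.Param),
            (∀ k, N.iter V g α θ₀ (DeepRitz.block P n) k ∈ K) →
            limsup (fun k => ((N.loss V g (N.iter V g α θ₀ (DeepRitz.block P n) k)
              - N.loss V g θs : ℝ) : EReal)) atTop
              ≤ ((C * ((n : ℝ)⁻¹ * Real.log n ^ N.dim) : ℝ) : EReal))) := by
  obtain ⟨Mg, hMg⟩ := hg
  have hVb : DeepRitz.Arch.IsAEBounded V (max Vmax Mg) := ⟨hVmeas, by
    filter_upwards [hV] with x hx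
    rw [abs_of_pos (hVmin.trans_le hx.1)]
    exact hx.2.trans (le_max_left _ _)⟩
  have hgb : DeepRitz.Arch.IsAEBounded g (max Vmax Mg) := ⟨hgmeas, by
    filter_upwards [hMg] with x hx
    exact hx.trans (le_max_right _ _)⟩
  refine ⟨DeepRitz.Arch.exists_gradLipschitzOn hVb hgb (N.isCompact_Theta B) (N.convex_Theta B),
    fun K hKΘ hKne hKcl hK L₇ c α hL hc hcL hsc hα hαL => ?_⟩
  have hKc : IsCompact K := (N.isCompact_Theta B).of_isClosed_subset hKcl hKΘ
  have hαL' : α * L₇ < 2 := (lt_div_iff₀ (hc.trans hcL)).1 hαL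
  obtain ⟨θs, hθs, hmin⟩ := hKc.exists_isMinOn hKne
    (DeepRitz.Arch.continuous_loss hVb hgb).continuousOn
  refine ⟨θs, hθs, hmin, ?_, fun hVd hgd => ?_⟩
  · obtain ⟨M, -, hM⟩ := N.exists_bound_gradIntegrand hKc (max Vmax Mg)
    have hM' : ∀ᵐ x ∂(DeepRitz.unif N.dim), ∀ θ ∈ K, ‖N.gradIntegrand V g x θ‖ ≤ M := by
      filter_upwards [DeepRitz.ae_unif_mem_cube _, hVb.le, hgb.le] with x hx h1 h2
      exact hM V g x hx h1 h2
    refine ⟨α ^ 2 * L₇ / 2 * (2 * M) ^ 2 / (1 - (1 - 2 * c * α * (1 - α * L₇ / 2))),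
      fun n hn S _ μ _ X θ₀ hX hlaw hind hiter => ?_⟩
    obtain ⟨h1, h2⟩ := DeepRitz.Arch.monteCarlo hVb hgb hK hKc hL hc hcL hsc hα hαL' hM' hθs hn hX
      hlaw hind hiter
    refine ⟨h1, h2.trans (EReal.coe_le_coe_iff.2 (le_of_eq ?_))⟩
    ring
  · obtain ⟨C, hC⟩ := DeepRitz.Arch.exists_quasiMonteCarlo hVb hgb hVd hgd hK hKc hL hc hcL hsc hα
      hαL' hθs
    refine ⟨fun R => ⟨C * R, fun n _ X θ₀ hX hD hiter => ?_⟩, fun t =>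
      ⟨C * (2 ^ t * (3 / Real.log 2) ^ N.dim), fun P hP τ hτ n hn θ₀ hiter => ?_⟩⟩
    · rw [mul_assoc]
      exact hC n X θ₀ _ hX hD hiter
    · subst hn
      rw [mul_assoc]
      exact hC _ _ θ₀ _ (fun k j i => ⟨(hP.1 _ i).1, (hP.1 _ i).2.le⟩)
        (fun k => hP.starDiscrepancy_block_le (N.width_pos 0 (Nat.zero_le _)) hτ k) hiter
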